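/- Let $U\subset\mathbb R^2$ be a bounded $C^2$ domain, $T,\varepsilon,\eta>0$, $g\in L^2(U)$, and let $\phi\in C^\infty(\mathbb R)$ be nondecreasing with $\phi(s)=-1$ for $s\le -1$, $\phi(s)=s$ for $0<s<1$ and $\phi(s)=2$ for $s\ge 2$. Let $(e_i)_{i\ge 1}$ be an orthogonal basis of $H^1(U)$ consisting of eigenfunctions of $-\Delta$ with homogeneous Neumann boundary conditions, normalized by $\|e_i\|_{L^2(U)}=1$, that is, functions $e_i\in C^2(U)\cap C^1(\overline U)$ with $-\Delta e_i=\lambda_i e_i$ in $U$ and $\partial_n e_i=0$ on $\partial U$. For $N\in\mathbb N$ let $V_N=\operatorname{Span}\{e_1,\dots,e_N\}$, let $\pi_N$ be the $L^2(U)$-orthogonal projection on $V_N$, and let $g_N=\pi_N[g]$. Given $(u_0,z_0)\in[L^2(U)]^2$ and an interval $J=[0,\tau)$ or $J=[0,\tau]$ with $\tau>0$, a Galerkin solution on $J$ is a pair $(u_N,z_N)$ with $u_N(t),z_N(t)\in V_N$ for $t\in J$, with $u_N(0)=\pi_N[u_0]$, $z_N(0)=\pi_N[z_0]$, and such that for every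 $t\in J$ and every $\psi\in V_N$ $$\frac{d}{dt}\int_U u_N(t)\psi\,dx=-\int_U(\eta+\phi(z_N(t))^2)\nabla u_N(t)\cdot\nabla\psi\,dx-\int_U(u_N(t)-g_N)\psi\,dx,$$ $$\frac{d}{dt}\int_U z_N(t)\psi\,dx=-2\varepsilon\int_U\nabla z_N(t)\cdot\nabla\psi\,dx-\int_U\phi'(z_N(t))\phi(z_N(t))|\nabla u_N(t)|^2\psi\,dx+\int_U\frac{1-z_N(t)}{2\varepsilon}\psi\,dx$$ (with one-sided derivatives at the endpoints belonging to $J$). **Proposition 2.5** (Existence of weak approximate solutions in $[0,T]$). Let $(u_0,z_0)\in[L^2(U)]^2$. There is a constant $C>0$, independent of $N$, such that the following holds for every $N$. 1. If $0<t_N\le T$ and $(u_N,z_N)$ is a Galerkin solution on $J=[0,t_N)$ or on $J=[0,t_N]$, then $$\sup_{t\in J}\|u_N(t)\|_{L^2(U)}^2+\int_0^{t_N}\|\nabla u_N(s)\|_{L^2(U)}^2\,ds\le C,\qquad \sup_{t\in J}\|z_N(t)\|_{L^2(U)}^2+\int_0^{t_N}\|\nabla z_N(s)\|_{L^2(U)}^2\,ds\le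 C.$$ 2. Every such $(u_N,z_N)$ extends to a Galerkin solution on $[0,T]$, which satisfies the same two bounds with $T$ in place of $t_N$ (so there is no blow-up before time $T$). 3. A Galerkin solution on $[0,T]$ exists, and it satisfies the same two bounds on $[0,T]$. -/

import Mathlib

noncomputable section

namespace AmbrosioTortorelli

/-- The Euclidean plane. -/
abbrev Plane : Type := EuclideanSpace ℝ (Fin 2)

/-- `ρ` is a `C²` defining function of the open set `U` in the neighbourhood `W` of `p`:
inside `W`, `U` is the sublevel set `{ρ < 0}`, and the gradient of `ρ` does not vanish at `p`. -/
structure IsLocalDefiningFunction (U : Set Plane) (p : Plane) (W : Set Plane) (ρ : Plane → ℝ) :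
    Prop where
  isOpen : IsOpen W
  mem : p ∈ W
  contDiffOn : ContDiffOn ℝ 2 ρ W
  gradient_ne_zero : gradient ρ p ≠ 0
  inter_eq : U ∩ W = {x ∈ W | ρ x < 0}

/-- A bounded `C²` domain of the plane: open, connected (in particular non-empty), bounded, with
boundary locally given by a `C²` defining function. -/
structure IsBoundedC2Domain (U : Set Plane) : Prop where
  isOpen : IsOpen U
  isConnected : IsConnected U
  isBounded : Bornology.IsBounded U
  boundary : ∀ p ∈ frontier U, ∃ (W : Set Plane) (ρ : Plane → ℝ), IsLocalDefiningFunction U p W ρ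

/-- `ν` is the outward unit normal of `U` at the boundary point `p`. -/
def IsOutwardUnitNormal (U : Set Plane) (p ν : Plane) : Prop :=
  ∃ (W : Set Plane) (ρ : Plane → ℝ), IsLocalDefiningFunction U p W ρ ∧
    ν = ‖gradient ρ p‖⁻¹ • gradient ρ p

/-- `e ∈ C²(U) ∩ C¹(closure U)` solves `-Δ e = lam e` in `U` and `∂ₙ e = 0` on `∂U`. The gradient
on `∂U` is the continuous extension of the gradient in `U`. -/
structure IsNeumannEigenfunction (U : Set Plane) (lam : ℝ) (e : Plane → ℝ) : Prop where
  contDiffOn : ContDiffOn ℝ 2 e U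
  continuousOn : ContinuousOn e (closure U)
  eigen : ∀ x ∈ U, -(Laplacian.laplacian e x) = lam * e x
  neumann : ∃ G : Plane → Plane, ContinuousOn G (closure U) ∧ Set.EqOn G (gradient e) U ∧
    ∀ p ∈ frontier U, ∀ ν : Plane, IsOutwardUnitNormal U p ν → inner ℝ (G p) ν = 0

/-- `v ∈ H¹(U)` with weak gradient `Dv`. -/
structure IsH1 (U : Set Plane) (v : Plane → ℝ) (Dv : Plane → Plane) : Prop where
  memLp : MeasureTheory.MemLp v 2 (MeasureTheory.volume.restrict U)
  memLp_grad : MeasureTheory.MemLp Dv 2 (MeasureTheory.volume.restrict U)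
  weak : ∀ ξ : Plane → ℝ, ContDiff ℝ (⊤ : ℕ∞) ξ → HasCompactSupport ξ → tsupport ξ ⊆ U →
    ∫ x in U, v x • gradient ξ x = -∫ x in U, ξ x • Dv x

/-- The span `V_N` of the first `N` functions of the sequence `e`. -/
def galerkinSpace (e : ℕ → Plane → ℝ) (N : ℕ) : Submodule ℝ (Plane → ℝ) :=
  Submodule.span ℝ (e '' {i | i < N})

/-- `e` is an orthogonal basis of `H¹(U)` made of eigenfunctions of `-Δ` with homogeneous Neumann
boundary conditions (eigenvalues `lam`), normalized in `L²(U)`. -/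
structure IsNeumannEigenbasis (U : Set Plane) (lam : ℕ → ℝ) (e : ℕ → Plane → ℝ) : Prop where
  eigenfunction : ∀ i, IsNeumannEigenfunction U (lam i) (e i)
  normalized : ∀ i, ∫ x in U, e i x ^ 2 = 1
  orthogonal : ∀ i j, i ≠ j →
    ∫ x in U, (e i x * e j x + inner ℝ (gradient (e i) x) (gradient (e j) x)) = 0
  dense : ∀ (v : Plane → ℝ) (Dv : Plane → Plane), IsH1 U v Dv → ∀ δ : ℝ, 0 < δ →
    ∃ N : ℕ, ∃ w ∈ galerkinSpace e N,
      ∫ x in U, ((v x - w x) ^ 2 + ‖Dv x - gradient w x‖ ^ 2) < δ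

/-- The smooth nondecreasing cutoff function. -/
structure IsCutoff (φ : ℝ → ℝ) : Prop where
  contDiff : ContDiff ℝ (⊤ : ℕ∞) φ
  monotone : Monotone φ
  left : ∀ s, s ≤ -1 → φ s = -1
  middle : ∀ s, 0 < s → s < 1 → φ s = s
  right : ∀ s, 2 ≤ s → φ s = 2

/-- `w` is the `L²(U)`-orthogonal projection of `f` on the space `V`. -/
def IsL2Projection (U : Set Plane) (V : Submodule ℝ (Plane → ℝ)) (f w : Plane → ℝ) : Prop :=
  w ∈ V ∧ ∀ ψ ∈ V, ∫ x in U, (f x - w x) * ψ x = 0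

/-- `(u, z)` solves on the time interval `J` (which contains `0`) the Galerkin system in `V_N`
`∂ₜ u = π_N[div((η + φ(z)²) ∇u)] - (u - π_N g)`,
`∂ₜ z = 2 ε Δz - π_N[φ'(z) φ(z) |∇u|²] + (1 - z) / (2 ε)`,
with `u(0) = π_N u₀`, `z(0) = π_N z₀` and homogeneous Neumann conditions, in the distributional
sense: the equations are tested with every `ψ ∈ V_N`, the divergence and the Laplacian being
integrated by parts without boundary term. -/
structure IsGalerkinSolution (U : Set Plane) (φ : ℝ → ℝ) (ε η : ℝ) (g u₀ z₀ : Plane → ℝ)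
    (e : ℕ → Plane → ℝ) (N : ℕ) (J : Set ℝ) (u z : ℝ → Plane → ℝ) : Prop where
  mem_u : ∀ t ∈ J, u t ∈ galerkinSpace e N
  mem_z : ∀ t ∈ J, z t ∈ galerkinSpace e N
  init_u : IsL2Projection U (galerkinSpace e N) u₀ (u 0)
  init_z : IsL2Projection U (galerkinSpace e N) z₀ (z 0)
  eq_u : ∃ gN : Plane → ℝ, IsL2Projection U (galerkinSpace e N) g gN ∧
    ∀ t ∈ J, ∀ ψ ∈ galerkinSpace e N,
      HasDerivWithinAt (fun s => ∫ x in U, u s x * ψ x)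
        (-(∫ x in U, (η + φ (z t x) ^ 2) * inner ℝ (gradient (u t) x) (gradient ψ x))
          - ∫ x in U, (u t x - gN x) * ψ x) J t
  eq_z : ∀ t ∈ J, ∀ ψ ∈ galerkinSpace e N,
      HasDerivWithinAt (fun s => ∫ x in U, z s x * ψ x)
        (-(2 * ε * ∫ x in U, inner ℝ (gradient (z t) x) (gradient ψ x))
          - (∫ x in U, deriv φ (z t x) * φ (z t x) * ‖gradient (u t) x‖ ^ 2 * ψ x)
          + ∫ x in U, (1 - z t x) / (2 * ε) * ψ x) J t

/-- `sup_{t ∈ J} ‖u(t)‖²_{L²(U)} + ∫_J ‖∇u(s)‖²_{L²(U)} ds ≤ C`, the supremum and the integral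
being finite. -/
def EnergyBound (U : Set Plane) (J : Set ℝ) (u : ℝ → Plane → ℝ) (C : ℝ) : Prop :=
  BddAbove (Set.range fun t : J => ∫ x in U, u t x ^ 2) ∧
  MeasureTheory.IntegrableOn (fun s => ∫ x in U, ‖gradient (u s) x‖ ^ 2) J ∧
  (⨆ t : J, ∫ x in U, u t x ^ 2) + ∫ s in J, ∫ x in U, ‖gradient (u s) x‖ ^ 2 ≤ C

end AmbrosioTortorelli

end

open MeasureTheory
open scoped Gradient


namespace AmbrosioTortorelli

/-! In coordinates with respect to an `L²(U)`-orthonormal basis of the Galerkin space, the system is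
an autonomous ordinary differential equation whose field is locally Lipschitz
(`locallyLipschitz_galerkinField`). Everything rests on energy estimates with constants independent
of the dimension.

Testing the equation of `u` with `u` controls `‖u‖²` and, since `η > 0`, the time integral of
`‖∇u‖²` (`weakRhsU_self_le`). Testing the equation of `z` with `z`, the only dangerous term is
`φ'(z) φ(z) z |∇u|²`. Its weight is bounded, because `φ'` vanishes outside `[-1, 2]`
(`IsCutoff.exists_bound`), so the term is at most a multiple of `‖∇u‖²`, which the first estimate
has already integrated (`weakRhsZ_self_le`, `apriori_bounds`). Bessel's inequality `sum_coeff_sq_le`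
replaces the norms of the projected data by those of the data, which removes `N`.

Global existence uses no maximal solution. The field is multiplied by a bump function, which makes
it bounded, and the truncated equation is the original one with time slowed by a factor in `[0, 1]`.
The energy estimates survive this slowing and keep the trajectory where the bump equals `1`
(`exists_hasDerivWithinAt_of_apriori`). By uniqueness (`eq_of_hasDerivWithinAt`) every local
solution is a restriction of this global one, which gives its bounds and its extension together. -/

/-- `v` is differentiable in `U`, and `v` and `∇v` are continuous and bounded in `U`. -/
structure IsBoundedC1 (U : Set Plane) (v : Plane → ℝ) : Prop where
  differentiableOn : DifferentiableOn ℝ v U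
  continuousOn_gradient : ContinuousOn (gradient v) U
  bounded : ∃ C, ∀ x ∈ U, |v x| ≤ C
  bounded_gradient : ∃ C, ∀ x ∈ U, ‖gradient v x‖ ≤ C

/-! ### Calculus and integrability for functions with bounded value and gradient. -/

variable {U : Set Plane}

lemma gradient_add_of_mem (hU : IsOpen U) {v w : Plane → ℝ} (hv : DifferentiableOn ℝ v U)
    (hw : DifferentiableOn ℝ w U) {x : Plane} (hx : x ∈ U) :
    gradient (v + w) x = gradient v x + gradient w x := by
  have h1 := (hv.differentiableAt (hU.mem_nhds hx))
  have h2 := (hw.differentiableAt (hU.mem_nhds hx))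
  simp [gradient, fderiv_add h1 h2]

lemma gradient_smul_of_mem (hU : IsOpen U) {v : Plane → ℝ} (hv : DifferentiableOn ℝ v U)
    (c : ℝ) {x : Plane} (hx : x ∈ U) :
    gradient (c • v) x = c • gradient v x := by
  have h1 := (hv.differentiableAt (hU.mem_nhds hx))
  simp [gradient, fderiv_const_smul h1 c]

/-- The space of differentiable functions with continuous bounded value and gradient. -/
def boundedC1 (hU : IsOpen U) : Submodule ℝ (Plane → ℝ) where
  carrier := {v | IsBoundedC1 U v}
  zero_mem' := by
    have h : gradient (0 : Plane → ℝ) = 0 := by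
      ext1 x; simp [gradient]
    refine ⟨differentiableOn_const 0, ?_, ⟨0, by simp⟩, ⟨0, by simp [h]⟩⟩
    rw [h]; exact continuousOn_const
  add_mem' := by
    rintro v w ⟨hv, hv', ⟨C, hC⟩, ⟨D, hD⟩⟩ ⟨hw, hw', ⟨C', hC'⟩, ⟨D', hD'⟩⟩
    refine ⟨hv.add hw, (hv'.add hw').congr fun x hx => gradient_add_of_mem hU hv hw hx,
      ⟨C + C', fun x hx => (abs_add_le _ _).trans (add_le_add (hC x hx) (hC' x hx))⟩,
      ⟨D + D', fun x hx => ?_⟩⟩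
    rw [gradient_add_of_mem hU hv hw hx]
    exact (norm_add_le _ _).trans (add_le_add (hD x hx) (hD' x hx))
  smul_mem' := by
    rintro c v ⟨hv, hv', ⟨C, hC⟩, ⟨D, hD⟩⟩
    refine ⟨hv.const_smul c, (hv'.const_smul c).congr fun x hx => gradient_smul_of_mem hU hv c hx,
      ⟨|c| * C, fun x hx => ?_⟩, ⟨|c| * D, fun x hx => ?_⟩⟩
    · simp only [Pi.smul_apply, smul_eq_mul, abs_mul]
      exact mul_le_mul_of_nonneg_left (hC x hx) (abs_nonneg c)
    · rw [gradient_smul_of_mem hU hv c hx, norm_smul, Real.norm_eq_abs]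
      exact mul_le_mul_of_nonneg_left (hD x hx) (abs_nonneg c)

lemma mem_boundedC1 {hU : IsOpen U} {v : Plane → ℝ} : v ∈ boundedC1 hU ↔ IsBoundedC1 U v := Iff.rfl

lemma gradient_sum_smul (hU : IsOpen U) {ι : Type*} (s : Finset ι) (a : ι → ℝ)
    {f : ι → Plane → ℝ} (hf : ∀ i, IsBoundedC1 U (f i)) {x : Plane} (hx : x ∈ U) :
    gradient (∑ i ∈ s, a i • f i) x = ∑ i ∈ s, a i • gradient (f i) x := by
  have h : ∀ i ∈ s, DifferentiableAt ℝ (a i • f i) x := fun i _ =>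
    ((hf i).differentiableOn.differentiableAt (hU.mem_nhds hx)).const_smul (a i)
  simp only [gradient, fderiv_sum h, map_sum]
  refine Finset.sum_congr rfl fun i _ => ?_
  rw [fderiv_const_smul ((hf i).differentiableOn.differentiableAt (hU.mem_nhds hx)) (a i), map_smul]

/-- The closure of `U` is compact, and both the eigenfunction and the extension of its gradient are
continuous there. -/
lemma IsNeumannEigenfunction.isBoundedC1 (hU : IsBoundedC2Domain U) {lam : ℝ} {e : Plane → ℝ}
    (he : IsNeumannEigenfunction U lam e) : IsBoundedC1 U e := by
  have hK : IsCompact (closure U) := hU.isBounded.isCompact_closure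
  obtain ⟨G, hG, hGe, -⟩ := he.neumann
  obtain ⟨C, hC⟩ := hK.exists_bound_of_continuousOn he.continuousOn
  obtain ⟨D, hD⟩ := hK.exists_bound_of_continuousOn hG
  refine ⟨he.contDiffOn.differentiableOn (by norm_num), (hG.mono subset_closure).congr hGe.symm,
    ⟨C, fun x hx => hC x (subset_closure hx)⟩, ⟨D, fun x hx => ?_⟩⟩
  rw [← hGe hx]
  exact hD x (subset_closure hx)

lemma integrableOn_of_bounded {E : Type*} [NormedAddCommGroup E] (hU : IsOpen U)
    (hb : Bornology.IsBounded U) {h : Plane → E} [SecondCountableTopology E] (hc : ContinuousOn h U)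
    (hB : ∃ C, ∀ x ∈ U, ‖h x‖ ≤ C) : IntegrableOn h U := by
  borelize E
  obtain ⟨C, hC⟩ := hB
  have : IsFiniteMeasure (volume.restrict U) := ⟨by simpa using hb.measure_lt_top⟩
  exact Integrable.of_bound (hc.aestronglyMeasurable hU.measurableSet) C
    ((ae_restrict_iff' hU.measurableSet).2 (Filter.Eventually.of_forall hC))

lemma IsBoundedC1.integrableOn_mul (hU : IsOpen U) (hb : Bornology.IsBounded U) {v w : Plane → ℝ}
    (hv : IsBoundedC1 U v) (hw : IsBoundedC1 U w) : IntegrableOn (fun x => v x * w x) U := by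
  obtain ⟨C, hC⟩ := hv.bounded
  obtain ⟨D, hD⟩ := hw.bounded
  refine integrableOn_of_bounded hU hb
    (hv.differentiableOn.continuousOn.mul hw.differentiableOn.continuousOn) ⟨C * D, fun x hx => ?_⟩
  rw [norm_mul]
  exact mul_le_mul (hC x hx) (hD x hx) (norm_nonneg _) ((abs_nonneg _).trans (hC x hx))

lemma IsBoundedC1.integrableOn_inner (hU : IsOpen U) (hb : Bornology.IsBounded U) {v w : Plane → ℝ}
    (hv : IsBoundedC1 U v) (hw : IsBoundedC1 U w) :
    IntegrableOn (fun x => inner ℝ (gradient v x) (gradient w x)) U := by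
  obtain ⟨C, hC⟩ := hv.bounded_gradient
  obtain ⟨D, hD⟩ := hw.bounded_gradient
  refine integrableOn_of_bounded hU hb
    (hv.continuousOn_gradient.inner hw.continuousOn_gradient) ⟨C * D, fun x hx => ?_⟩
  exact (norm_inner_le_norm _ _).trans
    (mul_le_mul (hC x hx) (hD x hx) (norm_nonneg _) ((norm_nonneg _).trans (hC x hx)))

lemma IsBoundedC1.memLp (hU : IsOpen U) (hb : Bornology.IsBounded U) {v : Plane → ℝ}
    (hv : IsBoundedC1 U v) : MemLp v 2 (volume.restrict U) := by
  rw [memLp_two_iff_integrable_sq (hv.differentiableOn.continuousOn.aestronglyMeasurable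
    hU.measurableSet)]
  simp only [sq]
  exact hv.integrableOn_mul hU hb hv

/-- Vanishing almost everywhere becomes vanishing everywhere because the function is continuous on
an open set. -/
lemma IsBoundedC1.eqOn_zero (hU : IsOpen U) (hb : Bornology.IsBounded U) {v : Plane → ℝ}
    (hv : IsBoundedC1 U v) (h : ∫ x in U, v x * v x = 0) : ∀ x ∈ U, v x = 0 := by
  have h0 := (integral_eq_zero_iff_of_nonneg (fun x => mul_self_nonneg (v x))
    (hv.integrableOn_mul hU hb hv)).1 h
  have h1 : v =ᵐ[volume.restrict U] (0 : Plane → ℝ) := by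
    filter_upwards [h0] with x hx
    simpa using hx
  exact Measure.eqOn_open_of_ae_eq h1 hU hv.differentiableOn.continuousOn continuousOn_const

/-! ### The Galerkin space as a finite-dimensional `L²(U)` inner product space. -/

section Eigenbasis

variable {lam : ℕ → ℝ} {e : ℕ → Plane → ℝ}

lemma galerkinSpace_le (hU : IsBoundedC2Domain U) (he : IsNeumannEigenbasis U lam e) (N : ℕ) :
    galerkinSpace e N ≤ boundedC1 hU.isOpen := by
  refine Submodule.span_le.2 ?_
  rintro _ ⟨i, -, rfl⟩
  exact (he.eigenfunction i).isBoundedC1 hU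

lemma exists_sum_of_mem_galerkinSpace {N : ℕ} {v : Plane → ℝ} (hv : v ∈ galerkinSpace e N) :
    ∃ c : ℕ → ℝ, v = ∑ i ∈ Finset.range N, c i • e i := by
  induction hv using Submodule.span_induction with
  | mem x hx =>
    obtain ⟨i, hi, rfl⟩ := hx
    refine ⟨Pi.single i 1, ?_⟩
    rw [Finset.sum_eq_single i]
    · simp
    · intro j _ hj; simp [hj]
    · intro h; exact absurd (Finset.mem_range.2 hi) h
  | zero => exact ⟨0, by simp⟩
  | add x y _ _ hx hy =>
    obtain ⟨c, rfl⟩ := hx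
    obtain ⟨d, rfl⟩ := hy
    exact ⟨c + d, by simp [add_smul, Finset.sum_add_distrib]⟩
  | smul r x _ hx =>
    obtain ⟨c, rfl⟩ := hx
    exact ⟨r • c, by simp [Finset.smul_sum, mul_smul]⟩

/-- A function of the Galerkin space which vanishes in `U` vanishes in the plane. -/
lemma eq_zero_of_mem_galerkinSpace (hU : IsBoundedC2Domain U) (he : IsNeumannEigenbasis U lam e)
    {N : ℕ} {v : Plane → ℝ} (hv : v ∈ galerkinSpace e N) (h : ∀ x ∈ U, v x = 0) : v = 0 := by
  obtain ⟨c, rfl⟩ := exists_sum_of_mem_galerkinSpace hv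
  have hb := fun i => (he.eigenfunction i).isBoundedC1 hU
  set v := ∑ i ∈ Finset.range N, c i • e i with hvdef
  have hg : ∀ x ∈ U, ∑ i ∈ Finset.range N, c i • gradient (e i) x = 0 := by
    intro x hx
    rw [← gradient_sum_smul hU.isOpen _ _ hb hx, ← hvdef]
    have : v =ᶠ[nhds x] fun _ => 0 := by
      filter_upwards [hU.isOpen.mem_nhds hx] with y hy using h y hy
    simp [gradient, this.fderiv_eq]
  have hint : ∀ i j, IntegrableOn
      (fun x => e i x * e j x + inner ℝ (gradient (e i) x) (gradient (e j) x)) U := fun i j =>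
    ((hb i).integrableOn_mul hU.isOpen hU.isBounded (hb j)).add
      ((hb i).integrableOn_inner hU.isOpen hU.isBounded (hb j))
  -- The values of the `e i` outside `U` are arbitrary, so it is not enough to know the sum on `U`:
  -- all coefficients must vanish. The `H¹` pairing of the sum with `e j` is zero, and orthogonality
  -- leaves only the `j`-th term.
  have hc : ∀ j ∈ Finset.range N, c j = 0 := by
    intro j hj
    have h1 : ∫ x in U, ∑ i ∈ Finset.range N,
        c i * (e i x * e j x + inner ℝ (gradient (e i) x) (gradient (e j) x)) = 0 := by
      rw [← integral_zero Plane ℝ (μ := volume.restrict U)]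
      refine setIntegral_congr_fun hU.isOpen.measurableSet fun x hx => ?_
      have e1 : ∑ i ∈ Finset.range N, c i * e i x = 0 := by
        have := h x hx
        simpa [hvdef] using this
      have e2 := congrArg (fun w => inner ℝ w (gradient (e j) x)) (hg x hx)
      simp only [sum_inner, inner_smul_left, inner_zero_left] at e2
      simp only [mul_add, Finset.sum_add_distrib, ← mul_assoc, ← Finset.sum_mul]
      rw [e1]
      simpa using e2
    rw [integral_finsetSum _ fun i _ => (hint i j).const_mul (c i)] at h1
    simp only [integral_const_mul] at h1
    rw [Finset.sum_eq_single j (fun i _ hij => by rw [he.orthogonal i j hij, mul_zero])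
      (fun hh => absurd hj hh)] at h1
    -- The squared `H¹` norm of `e j` is at least its squared `L²` norm, which is `1`.
    refine (mul_eq_zero.1 h1).resolve_right (ne_of_gt ?_)
    rw [integral_add ((hb j).integrableOn_mul hU.isOpen hU.isBounded (hb j))
      ((hb j).integrableOn_inner hU.isOpen hU.isBounded (hb j))]
    have h2 : 0 ≤ ∫ x in U, inner ℝ (gradient (e j) x) (gradient (e j) x) :=
      integral_nonneg fun x => real_inner_self_nonneg
    have h3 := he.normalized j
    simp only [sq] at h3
    linarith
  exact Finset.sum_eq_zero fun i hi => by rw [hc i hi, zero_smul]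

/-- The `L²(U)` inner product on the Galerkin space. -/
@[reducible]
noncomputable def galerkinCore (hU : IsBoundedC2Domain U) (he : IsNeumannEigenbasis U lam e) (N : ℕ) :
    InnerProductSpace.Core ℝ (galerkinSpace e N) where
  inner v w := ∫ x in U, v.1 x * w.1 x
  conj_inner_symm v w := by simp [mul_comm]
  re_inner_nonneg v := integral_nonneg fun x => mul_self_nonneg (v.1 x)
  add_left v w z := by
    have hb := fun v : galerkinSpace e N => galerkinSpace_le hU he N v.2
    rw [← integral_add ((hb v).integrableOn_mul hU.isOpen hU.isBounded (hb z))
      ((hb w).integrableOn_mul hU.isOpen hU.isBounded (hb z))]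
    simp [add_mul]
  smul_left v w r := by
    simp [mul_assoc, integral_const_mul]
  definite v hv := Subtype.ext <| eq_zero_of_mem_galerkinSpace hU he v.2 <|
    (galerkinSpace_le hU he N v.2).eqOn_zero hU.isOpen hU.isBounded hv

/-- The functions `f` form an `L²(U)`-orthonormal basis of the space `V`. -/
structure IsL2OrthonormalBasis (U : Set Plane) {n : ℕ} (f : Fin n → Plane → ℝ)
    (V : Submodule ℝ (Plane → ℝ)) : Prop where
  mem : ∀ i, f i ∈ V
  integral_mul : ∀ i j, ∫ x in U, f i x * f j x = if i = j then 1 else 0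
  eq_sum : ∀ v ∈ V, v = ∑ i, (∫ x in U, v x * f i x) • f i

/-- An abstract orthonormal basis is taken instead of the `e i` themselves: they are given as
orthogonal in `H¹`, and passing to `L²` orthogonality would need Green's formula. -/
lemma exists_isL2OrthonormalBasis (hU : IsBoundedC2Domain U) (he : IsNeumannEigenbasis U lam e)
    (N : ℕ) : ∃ (n : ℕ) (f : Fin n → Plane → ℝ), IsL2OrthonormalBasis U f (galerkinSpace e N) := by
  let core := galerkinCore hU he N
  let _ : NormedAddCommGroup (galerkinSpace e N) := core.toNormedAddCommGroup
  let _ : InnerProductSpace ℝ (galerkinSpace e N) := InnerProductSpace.ofCore core.toCore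
  have : FiniteDimensional ℝ (galerkinSpace e N) :=
    FiniteDimensional.span_of_finite ℝ ((Set.finite_lt_nat N).image e)
  have hin : ∀ v w : galerkinSpace e N, inner ℝ v w = ∫ x in U, v.1 x * w.1 x := fun v w => rfl
  let b := stdOrthonormalBasis ℝ (galerkinSpace e N)
  refine ⟨_, fun i => (b i).1, fun i => (b i).2, fun i j => ?_, fun v hv => ?_⟩
  · rw [← hin]
    exact orthonormal_iff_ite.1 b.orthonormal i j
  · have := congrArg Subtype.val (b.sum_repr' ⟨v, hv⟩)
    simp only [hin, AddSubmonoidClass.coe_finsetSum, Submodule.coe_smul] at this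
    refine this.symm.trans (Finset.sum_congr rfl fun i _ => ?_)
    simp only [mul_comm]

end Eigenbasis

end AmbrosioTortorelli

/-! ### Linear combinations, and integrability of the terms of the weak form. -/

namespace AmbrosioTortorelli

variable {U : Set Plane}

/-- The linear combination of the functions `f i` with coefficients `a i`. -/
def comb {n : ℕ} (f : Fin n → Plane → ℝ) (a : Fin n → ℝ) : Plane → ℝ := ∑ i, a i • f i

section Comb

variable {n : ℕ} {f : Fin n → Plane → ℝ}

lemma comb_apply (a : Fin n → ℝ) (x : Plane) : comb f a x = ∑ i, a i * f i x := by
  simp [comb]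

lemma gradient_comb (hU : IsOpen U) (hf : ∀ i, IsBoundedC1 U (f i)) (a : Fin n → ℝ) {x : Plane}
    (hx : x ∈ U) : gradient (comb f a) x = ∑ i, a i • gradient (f i) x :=
  gradient_sum_smul hU _ _ hf hx

lemma isBoundedC1_comb (hU : IsOpen U) (hf : ∀ i, IsBoundedC1 U (f i)) (a : Fin n → ℝ) :
    IsBoundedC1 U (comb f a) :=
  mem_boundedC1.1 (Submodule.sum_mem (boundedC1 hU) fun i _ => Submodule.smul_mem _ (a i) (hf i))

lemma integral_mul_comb {k : Plane → ℝ} (h : ∀ j, IntegrableOn (fun y => k y * f j y) U)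
    (c : Fin n → ℝ) :
    ∫ y in U, k y * comb f c y = ∑ j, c j * ∫ y in U, k y * f j y := by
  simp only [← integral_const_mul]
  rw [← integral_finsetSum _ fun j _ => (h j).const_mul (c j)]
  congr 1 with y
  rw [comb_apply, Finset.mul_sum]
  exact Finset.sum_congr rfl fun j _ => by ring

lemma integral_mul_inner_gradient_comb (hU : IsOpen U) (hf : ∀ i, IsBoundedC1 U (f i))
    {k : Plane → ℝ} {q : Plane → Plane}
    (h : ∀ j, IntegrableOn (fun y => k y * inner ℝ (q y) (gradient (f j) y)) U) (c : Fin n → ℝ) :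
    ∫ y in U, k y * inner ℝ (q y) (gradient (comb f c) y)
      = ∑ j, c j * ∫ y in U, k y * inner ℝ (q y) (gradient (f j) y) := by
  simp only [← integral_const_mul]
  rw [← integral_finsetSum _ fun j _ => (h j).const_mul (c j)]
  refine setIntegral_congr_fun hU.measurableSet fun y hy => ?_
  simp only [gradient_comb hU hf c hy, inner_sum, inner_smul_right, Finset.mul_sum]
  exact Finset.sum_congr rfl fun j _ => by ring

end Comb

section Integrability

variable {v w : Plane → ℝ}

lemma IsBoundedC1.bounded_comp (hv : IsBoundedC1 U v) {h : ℝ → ℝ} (hh : Continuous h) :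
    ∃ C, ∀ x ∈ U, |h (v x)| ≤ C := by
  obtain ⟨C, hC⟩ := hv.bounded
  obtain ⟨D, hD⟩ := (isCompact_Icc (a := -C) (b := C)).exists_bound_of_continuousOn hh.continuousOn
  exact ⟨D, fun x hx => hD _ (abs_le.1 (hC x hx))⟩

lemma integrableOn_weight_mul (hU : IsOpen U) (hb : Bornology.IsBounded U) {k h : Plane → ℝ}
    (hk : ContinuousOn k U) (hkb : ∃ C, ∀ x ∈ U, |k x| ≤ C) (hh : ContinuousOn h U)
    (hhb : ∃ C, ∀ x ∈ U, |h x| ≤ C) : IntegrableOn (fun x => k x * h x) U := by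
  obtain ⟨C, hC⟩ := hkb
  obtain ⟨D, hD⟩ := hhb
  refine integrableOn_of_bounded hU hb (hk.mul hh) ⟨C * D, fun x hx => ?_⟩
  rw [norm_mul]
  exact mul_le_mul (hC x hx) (hD x hx) (norm_nonneg _) ((abs_nonneg _).trans (hC x hx))

lemma IsBoundedC1.bounded_inner_gradient (hv : IsBoundedC1 U v) (hw : IsBoundedC1 U w) :
    ∃ C, ∀ x ∈ U, |inner ℝ (gradient v x) (gradient w x)| ≤ C := by
  obtain ⟨C, hC⟩ := hv.bounded_gradient
  obtain ⟨D, hD⟩ := hw.bounded_gradient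
  refine ⟨C * D, fun x hx => (abs_real_inner_le_norm _ _).trans ?_⟩
  exact mul_le_mul (hC x hx) (hD x hx) (norm_nonneg _) ((norm_nonneg _).trans (hC x hx))

lemma IsBoundedC1.integrableOn_comp_mul_inner (hU : IsOpen U) (hb : Bornology.IsBounded U)
    {u ψ : Plane → ℝ} (hu : IsBoundedC1 U u) (hv : IsBoundedC1 U v) (hψ : IsBoundedC1 U ψ)
    {h : ℝ → ℝ} (hh : Continuous h) :
    IntegrableOn (fun x => h (v x) * inner ℝ (gradient u x) (gradient ψ x)) U :=
  integrableOn_weight_mul hU hb (hh.comp_continuousOn hv.differentiableOn.continuousOn)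
    (hv.bounded_comp hh) (hu.continuousOn_gradient.inner hψ.continuousOn_gradient)
    (hu.bounded_inner_gradient hψ)

lemma IsBoundedC1.integrableOn_norm_gradient_sq (hU : IsOpen U) (hb : Bornology.IsBounded U)
    (hv : IsBoundedC1 U v) : IntegrableOn (fun x => ‖gradient v x‖ ^ 2) U := by
  simpa only [real_inner_self_eq_norm_sq] using hv.integrableOn_inner hU hb hv

lemma IsBoundedC1.integrableOn_comp_mul_norm_sq_mul (hU : IsOpen U) (hb : Bornology.IsBounded U)
    {u ψ : Plane → ℝ} (hu : IsBoundedC1 U u) (hv : IsBoundedC1 U v) (hψ : IsBoundedC1 U ψ)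
    {h : ℝ → ℝ} (hh : Continuous h) :
    IntegrableOn (fun x => h (v x) * ‖gradient u x‖ ^ 2 * ψ x) U := by
  obtain ⟨C, hC⟩ := hv.bounded_comp hh
  obtain ⟨D, hD⟩ := hu.bounded_inner_gradient hu
  refine integrableOn_weight_mul hU hb ((hh.comp_continuousOn
    hv.differentiableOn.continuousOn).mul (hu.continuousOn_gradient.norm.pow 2))
    ⟨C * D, fun x hx => ?_⟩ hψ.differentiableOn.continuousOn hψ.bounded
  rw [abs_mul, ← real_inner_self_eq_norm_sq]
  exact mul_le_mul (hC x hx) (hD x hx) (abs_nonneg _) ((abs_nonneg _).trans (hC x hx))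

end Integrability

/-! ### The weak right-hand sides: linearity in the test function and energy inequalities. -/

section WeakForm

variable {φ : ℝ → ℝ} {ε η : ℝ}

/-- The right-hand side of the equation of `u`, tested with `ψ`. -/
noncomputable def weakRhsU (U : Set Plane) (φ : ℝ → ℝ) (η : ℝ) (gN u z ψ : Plane → ℝ) : ℝ :=
  -(∫ x in U, (η + φ (z x) ^ 2) * inner ℝ (gradient u x) (gradient ψ x))
    - ∫ x in U, (u x - gN x) * ψ x

/-- The right-hand side of the equation of `z`, tested with `ψ`. -/
noncomputable def weakRhsZ (U : Set Plane) (φ : ℝ → ℝ) (ε : ℝ) (u z ψ : Plane → ℝ) : ℝ :=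
  -(2 * ε * ∫ x in U, inner ℝ (gradient z x) (gradient ψ x))
    - (∫ x in U, deriv φ (z x) * φ (z x) * ‖gradient u x‖ ^ 2 * ψ x)
    + ∫ x in U, (1 - z x) / (2 * ε) * ψ x

lemma IsCutoff.continuous (hφ : IsCutoff φ) : Continuous φ := hφ.contDiff.continuous

lemma IsCutoff.contDiff_deriv (hφ : IsCutoff φ) : ContDiff ℝ 1 (deriv φ) :=
  (contDiff_infty_iff_deriv.1 hφ.contDiff).2.of_le (by exact_mod_cast le_top)

lemma IsCutoff.continuous_deriv_mul (hφ : IsCutoff φ) :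
    Continuous fun s => deriv φ s * φ s :=
  hφ.contDiff_deriv.continuous.mul hφ.continuous

/-- Only values of the phase field in `[-1, 2]` contribute to `φ' φ`. -/
lemma IsCutoff.exists_bound (hφ : IsCutoff φ) :
    ∃ M, 0 ≤ M ∧ ∀ s, |deriv φ s * φ s * s| ≤ M := by
  obtain ⟨M, hM⟩ := (isCompact_Icc (a := (-1 : ℝ)) (b := 2)).exists_bound_of_continuousOn
    (hφ.continuous_deriv_mul.mul continuous_id).continuousOn
  have hM0 : 0 ≤ M := (norm_nonneg _).trans (hM 0 (by norm_num))
  refine ⟨M, hM0, fun s => ?_⟩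
  by_cases h : s ∈ Set.Icc (-1 : ℝ) 2
  · exact hM s h
  · have hd : deriv φ s = 0 := by
      rw [Set.mem_Icc, not_and_or, not_le, not_le] at h
      rcases h with h | h
      · have : φ =ᶠ[nhds s] fun _ => -1 := by
          filter_upwards [Iio_mem_nhds h] with y hy using hφ.left y (le_of_lt hy)
        rw [this.deriv_eq, deriv_const]
      · have : φ =ᶠ[nhds s] fun _ => 2 := by
          filter_upwards [Ioi_mem_nhds h] with y hy using hφ.right y (le_of_lt hy)
        rw [this.deriv_eq, deriv_const]
    simpa [hd] using hM0

variable {n : ℕ} {f : Fin n → Plane → ℝ}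

lemma weakRhsU_comb (hU : IsOpen U) (hb : Bornology.IsBounded U) (hφ : IsCutoff φ)
    (hf : ∀ i, IsBoundedC1 U (f i)) {gN u z : Plane → ℝ} (hg : IsBoundedC1 U gN)
    (hu : IsBoundedC1 U u) (hz : IsBoundedC1 U z) (c : Fin n → ℝ) :
    weakRhsU U φ η gN u z (comb f c) = ∑ j, c j * weakRhsU U φ η gN u z (f j) := by
  have hh : Continuous fun s => η + φ s ^ 2 := continuous_const.add (hφ.continuous.pow 2)
  have hd : IsBoundedC1 U (u - gN) := Submodule.sub_mem (boundedC1 hU) hu hg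
  unfold weakRhsU
  rw [integral_mul_inner_gradient_comb hU hf (k := fun x => η + φ (z x) ^ 2)
      (fun j => hu.integrableOn_comp_mul_inner hU hb hz (hf j) hh),
    integral_mul_comb (k := fun x => u x - gN x)
      (fun j => hd.integrableOn_mul hU hb (hf j)), ← Finset.sum_neg_distrib,
    ← Finset.sum_sub_distrib]
  exact Finset.sum_congr rfl fun j _ => by ring

lemma isBoundedC1_const (c : ℝ) : IsBoundedC1 U fun _ => c := by
  have h : gradient (fun _ : Plane => c) = 0 := by
    ext1 x; simp [gradient]
  refine ⟨differentiableOn_const c, ?_, ⟨|c|, by simp⟩, ⟨0, by simp [h]⟩⟩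
  rw [h]; exact continuousOn_const

lemma weakRhsZ_comb (hU : IsOpen U) (hb : Bornology.IsBounded U) (hφ : IsCutoff φ)
    (hf : ∀ i, IsBoundedC1 U (f i)) {u z : Plane → ℝ}
    (hu : IsBoundedC1 U u) (hz : IsBoundedC1 U z) (c : Fin n → ℝ) :
    weakRhsZ U φ ε u z (comb f c) = ∑ j, c j * weakRhsZ U φ ε u z (f j) := by
  have hd : IsBoundedC1 U ((2 * ε)⁻¹ • ((fun _ => 1) - z)) :=
    Submodule.smul_mem (boundedC1 hU) _ (Submodule.sub_mem _ (isBoundedC1_const 1) hz)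
  have hd' : ∀ j, IntegrableOn (fun x => (1 - z x) / (2 * ε) * f j x) U := fun j => by
    have := hd.integrableOn_mul hU hb (hf j)
    simp only [Pi.smul_apply, Pi.sub_apply, smul_eq_mul] at this
    simpa only [div_eq_inv_mul] using this
  have h1 := integral_mul_inner_gradient_comb hU hf (k := fun _ => 1) (q := gradient z)
      (fun j => by simpa only [one_mul] using hz.integrableOn_inner hU hb (hf j)) c
  simp only [one_mul] at h1
  unfold weakRhsZ
  rw [h1, integral_mul_comb (k := fun x => deriv φ (z x) * φ (z x) * ‖gradient u x‖ ^ 2)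
      (fun j => hu.integrableOn_comp_mul_norm_sq_mul hU hb hz (hf j) hφ.continuous_deriv_mul),
    integral_mul_comb (k := fun x => (1 - z x) / (2 * ε)) hd', Finset.mul_sum,
    ← Finset.sum_neg_distrib, ← Finset.sum_sub_distrib, ← Finset.sum_add_distrib]
  exact Finset.sum_congr rfl fun j _ => by ring

/-- The term with `φ(z)²` is nonnegative and is dropped. For the fidelity term, `2 (u - g) u = (u -
g)² + u² - g² ≥ -g²`. -/
lemma weakRhsU_self_le (hU : IsOpen U) (hb : Bornology.IsBounded U) (hφ : IsCutoff φ)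
    {gN u z : Plane → ℝ} (hg : IsBoundedC1 U gN) (hu : IsBoundedC1 U u) (hz : IsBoundedC1 U z) :
    2 * weakRhsU U φ η gN u z u
      ≤ -(2 * η) * (∫ x in U, ‖gradient u x‖ ^ 2) + ∫ x in U, gN x ^ 2 := by
  have hh : Continuous fun s => η + φ s ^ 2 := continuous_const.add (hφ.continuous.pow 2)
  have hd : IsBoundedC1 U (u - gN) := Submodule.sub_mem (boundedC1 hU) hu hg
  have hgi : IntegrableOn (fun x => gN x ^ 2) U := by
    simpa only [sq] using hg.integrableOn_mul hU hb hg
  have h1 : η * ∫ x in U, ‖gradient u x‖ ^ 2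
      ≤ ∫ x in U, (η + φ (z x) ^ 2) * inner ℝ (gradient u x) (gradient u x) := by
    rw [← integral_const_mul]
    refine integral_mono ((hu.integrableOn_norm_gradient_sq hU hb).const_mul η)
      (hu.integrableOn_comp_mul_inner hU hb hz hu hh) fun x => ?_
    simp only [real_inner_self_eq_norm_sq, add_mul]
    nlinarith [mul_nonneg (sq_nonneg (φ (z x))) (sq_nonneg ‖gradient u x‖)]
  have h2 : -(∫ x in U, gN x ^ 2) ≤ 2 * ∫ x in U, (u x - gN x) * u x := by
    rw [← integral_neg, ← integral_const_mul]
    refine integral_mono hgi.neg ((hd.integrableOn_mul hU hb hu).const_mul 2) fun x => ?_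
    nlinarith [sq_nonneg (u x - gN x), sq_nonneg (u x)]
  unfold weakRhsU
  linarith

/-- The factor `z` supplied by the test function is absorbed by `φ' φ`, at the price of `M`, so no
norm of `z` multiplies `|∇u|²`. The reaction term is bounded by completing the square: `(1 - z) z ≤
1 / 4`. -/
lemma weakRhsZ_self_le (hU : IsOpen U) (hb : Bornology.IsBounded U) (hφ : IsCutoff φ)
    {M : ℝ} (hM : ∀ s, |deriv φ s * φ s * s| ≤ M) (hε : 0 < ε)
    {u z : Plane → ℝ} (hu : IsBoundedC1 U u) (hz : IsBoundedC1 U z) :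
    2 * weakRhsZ U φ ε u z z
      ≤ -(4 * ε) * (∫ x in U, ‖gradient z x‖ ^ 2) + 2 * M * (∫ x in U, ‖gradient u x‖ ^ 2)
        + volume.real U / (4 * ε) := by
  have hd : IsBoundedC1 U ((2 * ε)⁻¹ • ((fun _ => 1) - z)) :=
    Submodule.smul_mem (boundedC1 hU) _ (Submodule.sub_mem _ (isBoundedC1_const 1) hz)
  have hd' : IntegrableOn (fun x => (1 - z x) / (2 * ε) * z x) U := by
    have := hd.integrableOn_mul hU hb hz
    simp only [Pi.smul_apply, Pi.sub_apply, smul_eq_mul] at this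
    simpa only [div_eq_inv_mul] using this
  have h2 : -(M * ∫ x in U, ‖gradient u x‖ ^ 2)
      ≤ ∫ x in U, deriv φ (z x) * φ (z x) * ‖gradient u x‖ ^ 2 * z x := by
    rw [← integral_const_mul, ← integral_neg]
    refine integral_mono ((hu.integrableOn_norm_gradient_sq hU hb).const_mul M).neg
      (hu.integrableOn_comp_mul_norm_sq_mul hU hb hz hz hφ.continuous_deriv_mul) fun x => ?_
    have := (abs_le.1 (hM (z x))).1
    have := mul_le_mul_of_nonneg_right this (sq_nonneg ‖gradient u x‖)
    linarith
  have h3 : ∫ x in U, (1 - z x) / (2 * ε) * z x ≤ volume.real U / (8 * ε) := by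
    have h4 : ∫ x in U, (1 - z x) / (2 * ε) * z x ≤ ∫ _ in U, 1 / (8 * ε) := by
      refine integral_mono hd' (integrableOn_const hb.measure_lt_top.ne) fun x => ?_
      simp only
      rw [div_mul_eq_mul_div, div_le_div_iff₀ (by positivity) (by positivity)]
      nlinarith [mul_nonneg hε.le (sq_nonneg (2 * z x - 1))]
    rw [setIntegral_const, smul_eq_mul, mul_one_div] at h4
    exact h4
  have h5 : volume.real U / (4 * ε) = 2 * (volume.real U / (8 * ε)) := by
    ring
  unfold weakRhsZ
  simp only [real_inner_self_eq_norm_sq]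
  linarith

end WeakForm

/-! ### Local Lipschitz dependence of the right-hand sides on the coefficients. -/

section Lipschitz

/-- The point `y` enters only through `m y`, which stays in a compact ball. Hence one Lipschitz
constant of `Ψ` serves all `y`, and integration multiplies it by the finite measure of `U`. -/
lemma locallyLipschitz_setIntegral (hU : IsOpen U) (hb : Bornology.IsBounded U)
    {X M : Type*} [NormedAddCommGroup X] [NormedSpace ℝ X] [FiniteDimensional ℝ X]
    [NormedAddCommGroup M] [NormedSpace ℝ M] [FiniteDimensional ℝ M]
    {Ψ : X × M → ℝ} (hΨ : ContDiff ℝ 1 Ψ) {m : Plane → M} (hm : ContinuousOn m U)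
    (hmb : ∃ C, ∀ y ∈ U, ‖m y‖ ≤ C) : LocallyLipschitz fun x => ∫ y in U, Ψ (x, m y) := by
  have := FiniteDimensional.proper_real X
  have := FiniteDimensional.proper_real M
  obtain ⟨C, hC⟩ := hmb
  intro x₀
  have hcpt : IsCompact (Metric.closedBall x₀ 1 ×ˢ Metric.closedBall (0 : M) C) :=
    (isCompact_closedBall x₀ 1).prod (isCompact_closedBall 0 C)
  obtain ⟨K, hK⟩ := hΨ.locallyLipschitz.locallyLipschitzOn.exists_lipschitzOnWith_of_compact hcpt
  obtain ⟨B, hB⟩ := hcpt.exists_bound_of_continuousOn hΨ.continuous.continuousOn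
  have hmem : ∀ x ∈ Metric.closedBall x₀ 1, ∀ y ∈ U,
      (x, m y) ∈ Metric.closedBall x₀ 1 ×ˢ Metric.closedBall (0 : M) C := fun x hx y hy =>
    ⟨hx, by simpa using hC y hy⟩
  have hint : ∀ x ∈ Metric.closedBall x₀ 1, IntegrableOn (fun y => Ψ (x, m y)) U := fun x hx =>
    integrableOn_of_bounded hU hb
      (hΨ.continuous.comp_continuousOn (continuousOn_const.prodMk hm))
      ⟨B, fun y hy => hB _ (hmem x hx y hy)⟩
  refine ⟨K * (volume.real U).toNNReal, _, Metric.closedBall_mem_nhds x₀ one_pos,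
    LipschitzOnWith.of_dist_le_mul fun x hx x' hx' => ?_⟩
  rw [dist_eq_norm, ← integral_sub (hint x hx) (hint x' hx')]
  refine (norm_setIntegral_le_of_norm_le_const (C := K * dist x x') hb.measure_lt_top
    fun y hy => ?_).trans_eq ?_
  · rw [← dist_eq_norm]
    refine (hK.dist_le_mul _ (hmem x hx y hy) _ (hmem x' hx' y hy)).trans_eq ?_
    rw [Prod.dist_eq, dist_self, max_eq_left dist_nonneg]
  · rw [NNReal.coe_mul, Real.coe_toNNReal _ measureReal_nonneg]
    ring

lemma locallyLipschitz_pi {X : Type*} [PseudoEMetricSpace X] {n : ℕ} {F : X → Fin n → ℝ}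
    (h : ∀ j, LocallyLipschitz fun x => F x j) : LocallyLipschitz F := by
  intro x
  choose K t ht hK using fun j => h j x
  refine ⟨∑ j, K j, ⋂ j, t j, Filter.iInter_mem.2 ht, fun y hy y' hy' => ?_⟩
  refine edist_pi_le_iff.2 fun j => (hK j (Set.mem_iInter.1 hy j) (Set.mem_iInter.1 hy' j)).trans ?_
  gcongr
  exact Finset.single_le_sum (f := K) (fun _ _ => zero_le) (Finset.mem_univ j)

variable {φ : ℝ → ℝ} {ε η : ℝ} {n : ℕ} {f : Fin n → Plane → ℝ}

/-- The values and gradients of the functions `f i` at a point. -/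
noncomputable def jet (f : Fin n → Plane → ℝ) (y : Plane) : (Fin n → ℝ) × (Fin n → Plane) :=
  (fun i => f i y, fun i => gradient (f i) y)

lemma continuousOn_jet (hf : ∀ i, IsBoundedC1 U (f i)) : ContinuousOn (jet f) U :=
  (continuousOn_pi.2 fun i => (hf i).differentiableOn.continuousOn).prodMk
    (continuousOn_pi.2 fun i => (hf i).continuousOn_gradient)

lemma bounded_jet (hf : ∀ i, IsBoundedC1 U (f i)) : ∃ C, ∀ y ∈ U, ‖jet f y‖ ≤ C := by
  choose C hC using fun i => (hf i).bounded
  choose D hD using fun i => (hf i).bounded_gradient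
  refine ⟨∑ i, (|C i| + |D i|), fun y hy => ?_⟩
  have hle : ∀ i, |C i| + |D i| ≤ ∑ i, (|C i| + |D i|) := fun i =>
    Finset.single_le_sum (f := fun i => |C i| + |D i|) (fun _ _ => by positivity)
      (Finset.mem_univ i)
  have h0 : 0 ≤ ∑ i, (|C i| + |D i|) := Finset.sum_nonneg fun _ _ => by positivity
  refine max_le ((pi_norm_le_iff_of_nonneg h0).2 fun i => ?_)
    ((pi_norm_le_iff_of_nonneg h0).2 fun i => ?_)
  · have := hC i y hy
    have := le_abs_self (C i)
    have := abs_nonneg (D i)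
    exact le_trans (by simp only [jet, Real.norm_eq_abs]; linarith) (hle i)
  · have := hD i y hy
    have := le_abs_self (D i)
    have := abs_nonneg (C i)
    exact le_trans (by simp only [jet]; linarith) (hle i)

/-- Every integrand of the system is a `C¹` function of the coefficients and of the values and
gradients of the basis at `y`, so only that function has to be exhibited. -/
lemma locallyLipschitz_setIntegral_jet (hU : IsOpen U) (hb : Bornology.IsBounded U)
    (hf : ∀ i, IsBoundedC1 U (f i))
    {Ψ : ((Fin n → ℝ) × (Fin n → ℝ)) × ((Fin n → ℝ) × (Fin n → Plane)) → ℝ}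
    (hΨ : ContDiff ℝ 1 Ψ) {k : (Fin n → ℝ) × (Fin n → ℝ) → Plane → ℝ}
    (hk : ∀ x, ∀ y ∈ U, k x y = Ψ (x, jet f y)) :
    LocallyLipschitz fun x => ∫ y in U, k x y := by
  have := locallyLipschitz_setIntegral hU hb hΨ (continuousOn_jet hf) (bounded_jet hf)
  rwa [← funext fun x => setIntegral_congr_fun hU.measurableSet fun y hy => hk x y hy] at this

lemma locallyLipschitz_weakRhsU (hU : IsOpen U) (hb : Bornology.IsBounded U) (hφ : IsCutoff φ)
    (hf : ∀ i, IsBoundedC1 U (f i)) (γ : Fin n → ℝ) (j : Fin n) :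
    LocallyLipschitz fun x : (Fin n → ℝ) × (Fin n → ℝ) =>
      weakRhsU U φ η (comb f γ) (comb f x.1) (comb f x.2) (f j) := by
  have hφ1 : ContDiff ℝ 1 φ := hφ.contDiff.of_le (by exact_mod_cast le_top)
  refine LocallyLipschitz.sub (LocallyLipschitz.neg ?_) ?_
  · refine locallyLipschitz_setIntegral_jet hU hb hf (Ψ := fun p =>
      (η + φ (∑ i, p.1.2 i * p.2.1 i) ^ 2) * inner ℝ (∑ i, p.1.1 i • p.2.2 i) (p.2.2 j))
      ?_ fun x y hy => ?_
    · refine ContDiff.mul (contDiff_const.add (ContDiff.pow (hφ1.comp ?_) 2))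
        (ContDiff.inner ℝ ?_ ?_) <;> fun_prop
    · rw [gradient_comb hU hf _ hy, comb_apply]; rfl
  · refine locallyLipschitz_setIntegral_jet hU hb hf (Ψ := fun p =>
      (∑ i, p.1.1 i * p.2.1 i - ∑ i, γ i * p.2.1 i) * p.2.1 j) ?_ fun x y hy => ?_
    · fun_prop
    · rw [comb_apply, comb_apply]; rfl

lemma locallyLipschitz_weakRhsZ (hU : IsOpen U) (hb : Bornology.IsBounded U) (hφ : IsCutoff φ)
    (hf : ∀ i, IsBoundedC1 U (f i)) (j : Fin n) :
    LocallyLipschitz fun x : (Fin n → ℝ) × (Fin n → ℝ) =>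
      weakRhsZ U φ ε (comb f x.1) (comb f x.2) (f j) := by
  have hφ1 : ContDiff ℝ 1 φ := hφ.contDiff.of_le (by exact_mod_cast le_top)
  have hφ2 := hφ.contDiff_deriv
  simp only [weakRhsZ, ← integral_const_mul]
  refine LocallyLipschitz.add (LocallyLipschitz.sub (LocallyLipschitz.neg ?_) ?_) ?_
  · refine locallyLipschitz_setIntegral_jet hU hb hf (Ψ := fun p =>
      2 * ε * inner ℝ (∑ i, p.1.2 i • p.2.2 i) (p.2.2 j)) ?_ fun x y hy => ?_
    · refine contDiff_const.mul (ContDiff.inner ℝ ?_ ?_) <;> fun_prop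
    · rw [gradient_comb hU hf _ hy]; rfl
  · refine locallyLipschitz_setIntegral_jet hU hb hf (Ψ := fun p =>
      deriv φ (∑ i, p.1.2 i * p.2.1 i) * φ (∑ i, p.1.2 i * p.2.1 i)
        * ‖∑ i, p.1.1 i • p.2.2 i‖ ^ 2 * p.2.1 j) ?_ fun x y hy => ?_
    · refine ContDiff.mul (ContDiff.mul (ContDiff.mul (hφ2.comp ?_) (hφ1.comp ?_))
        (ContDiff.norm_sq ℝ ?_)) ?_ <;> fun_prop
    · rw [gradient_comb hU hf _ hy, comb_apply]; rfl
  · refine locallyLipschitz_setIntegral_jet hU hb hf (Ψ := fun p =>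
      (1 - ∑ i, p.1.2 i * p.2.1 i) / (2 * ε) * p.2.1 j) ?_ fun x y hy => ?_
    · fun_prop
    · rw [comb_apply]; rfl

/-- Used to make the dissipation continuous, hence integrable, along a trajectory. -/
lemma continuous_dirichlet_comb (hU : IsOpen U) (hb : Bornology.IsBounded U)
    (hf : ∀ i, IsBoundedC1 U (f i)) :
    Continuous fun a : Fin n → ℝ => ∫ y in U, ‖gradient (comb f a) y‖ ^ 2 := by
  have h : LocallyLipschitz fun x : (Fin n → ℝ) × (Fin n → ℝ) =>
      ∫ y in U, ‖gradient (comb f x.1) y‖ ^ 2 := by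
    refine locallyLipschitz_setIntegral_jet hU hb hf (Ψ := fun p =>
      ‖∑ i, p.1.1 i • p.2.2 i‖ ^ 2) ?_ fun x y hy => ?_
    · refine ContDiff.norm_sq ℝ ?_; fun_prop
    · rw [gradient_comb hU hf _ hy]; rfl
  have h' := h.continuous
  exact h'.comp (f := fun a : Fin n → ℝ => (a, (0 : Fin n → ℝ))) (by fun_prop)

end Lipschitz

end AmbrosioTortorelli

namespace AmbrosioTortorelli

/-! ### Existence, uniqueness and comparison for ordinary differential equations. -/

section ODE

variable {X : Type*} [NormedAddCommGroup X] [NormedSpace ℝ X]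

lemma continuousOn_Icc_of_hasDerivWithinAt {F : ℝ → X} {α : ℝ → X} {J : Set ℝ} {t : ℝ}
    (hJ : Set.Icc 0 t ⊆ J)
    (hα : ∀ s ∈ J, HasDerivWithinAt α (F s) J s) : ContinuousOn α (Set.Icc 0 t) :=
  fun s hs => ((hα s (hJ hs)).mono hJ).continuousWithinAt

lemma hasDerivWithinAt_Ici_of_Icc {F : X} {α : ℝ → X} {J : Set ℝ} {s t : ℝ}
    (hJ : Set.Icc 0 t ⊆ J) (hs : s ∈ Set.Ico 0 t) (hα : HasDerivWithinAt α F J s) :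
    HasDerivWithinAt α F (Set.Ici s) s := by
  refine (hα.mono hJ).mono_of_mem_nhdsWithin ?_
  refine Filter.mem_of_superset (Icc_mem_nhdsGE hs.2) ?_
  exact Set.Icc_subset_Icc_left hs.1

variable [FiniteDimensional ℝ X]

/-- Global existence on `[0, T]` for a locally Lipschitz field, from an a priori bound which is
stable under slowing down the time by a factor `χ ∈ [0, 1]`. -/
theorem exists_hasDerivWithinAt_of_apriori {F : X → X} (hF : LocallyLipschitz F) {x₀ : X}
    {T R : ℝ} (hT : 0 ≤ T) (hap : ∀ (χ : ℝ → ℝ) (α : ℝ → X), ContinuousOn χ (Set.Icc 0 T) →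
      (∀ t, 0 ≤ χ t ∧ χ t ≤ 1) → α 0 = x₀ →
      (∀ t ∈ Set.Icc 0 T, HasDerivWithinAt α (χ t • F (α t)) (Set.Icc 0 T) t) →
      ∀ t ∈ Set.Icc 0 T, ‖α t‖ ≤ R) :
    ∃ α : ℝ → X, α 0 = x₀ ∧ ∀ t ∈ Set.Icc 0 T, HasDerivWithinAt α (F (α t)) (Set.Icc 0 T) t := by
  have := FiniteDimensional.proper_real X
  have hR : 0 < |R| + 1 := by positivity
  -- The absolute value makes the radii positive whatever the sign of `R`; the bump equals `1` on a
  -- ball containing the one of radius `R`.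
  let b : ContDiffBump (0 : X) := ⟨|R| + 1, |R| + 2, hR, by linarith⟩
  have hb1 : ContDiff ℝ 1 b := b.contDiff
  have hloc : LocallyLipschitz fun x => b x • F x := by
    have h : ContDiff ℝ 1 fun p : ℝ × X => p.1 • p.2 := contDiff_fst.smul contDiff_snd
    exact h.locallyLipschitz.comp (hb1.locallyLipschitz.prodMk hF)
  have hsupp : HasCompactSupport fun x => b x • F x := b.hasCompactSupport.smul_right
  obtain ⟨L, hL⟩ := hsupp.exists_bound_of_continuous hloc.continuous
  have hL0 : 0 ≤ L := (norm_nonneg _).trans (hL 0)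
  -- With speed at most `L`, a trajectory stays within `L * T` of `x₀` up to time `T`. A Lipschitz
  -- constant on that ball therefore lets Picard–Lindelöf reach `T` in a single step.
  obtain ⟨K, hK⟩ := hloc.locallyLipschitzOn.exists_lipschitzOnWith_of_compact
    (isCompact_closedBall x₀ (L * T))
  have hPL : IsPicardLindelof (fun _ x => b x • F x) (⟨0, le_rfl, hT⟩ : Set.Icc 0 T) x₀
      ⟨L * T, mul_nonneg hL0 hT⟩ 0 ⟨L, hL0⟩ K := by
    refine .of_time_independent (fun x _ => hL x) hK ?_
    change L * max (T - 0) (0 - 0) ≤ L * T - 0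
    simp [hT]
  obtain ⟨α, h0, hα⟩ := hPL.exists_eq_forall_mem_Icc_hasDerivWithinAt₀
  have hcont : ContinuousOn α (Set.Icc 0 T) := fun t ht => (hα t ht).continuousWithinAt
  -- The truncated solution follows the original field slowed down by `χ t = b (α t)`, so the a
  -- priori bound applies and in turn forces this factor to be `1`.
  have hbound := hap (fun t => b (α t)) α (b.continuous.comp_continuousOn hcont)
    (fun t => ⟨b.nonneg, b.le_one⟩) h0 hα
  refine ⟨α, h0, fun t ht => ?_⟩
  have h1 : b (α t) = 1 := by
    refine b.one_of_mem_closedBall ?_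
    have := (hbound t ht).trans (le_abs_self R)
    simp only [Metric.mem_closedBall, dist_zero_right, b]
    linarith
  simpa [h1] using hα t ht

/-- Uniqueness of solutions of an autonomous equation with locally Lipschitz field. -/
theorem eq_of_hasDerivWithinAt {F : X → X} (hF : LocallyLipschitz F) {α β : ℝ → X}
    {J J' : Set ℝ} {t : ℝ} (ht : 0 ≤ t) (hJ : Set.Icc 0 t ⊆ J) (hJ' : Set.Icc 0 t ⊆ J')
    (hα : ∀ s ∈ J, HasDerivWithinAt α (F (α s)) J s)
    (hβ : ∀ s ∈ J', HasDerivWithinAt β (F (β s)) J' s) (h0 : α 0 = β 0) : α t = β t := by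
  have := FiniteDimensional.proper_real X
  have hαc := continuousOn_Icc_of_hasDerivWithinAt hJ hα
  have hβc := continuousOn_Icc_of_hasDerivWithinAt hJ' hβ
  -- A local Lipschitz condition is uniform on the compact union of the two trajectories, which is
  -- all that the Grönwall argument needs.
  have hcpt : IsCompact (α '' Set.Icc 0 t ∪ β '' Set.Icc 0 t) :=
    (isCompact_Icc.image_of_continuousOn hαc).union (isCompact_Icc.image_of_continuousOn hβc)
  obtain ⟨K, hK⟩ := hF.locallyLipschitzOn.exists_lipschitzOnWith_of_compact hcpt
  exact ODE_solution_unique_of_mem_Icc_right (v := fun _ => F)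
    (s := fun _ => α '' Set.Icc 0 t ∪ β '' Set.Icc 0 t) (fun _ _ => hK) hαc
    (fun s hs => hasDerivWithinAt_Ici_of_Icc hJ hs (hα s (hJ (Set.Ico_subset_Icc_self hs))))
    (fun s hs => Or.inl (Set.mem_image_of_mem _ (Set.Ico_subset_Icc_self hs))) hβc
    (fun s hs => hasDerivWithinAt_Ici_of_Icc hJ' hs (hβ s (hJ' (Set.Ico_subset_Icc_self hs))))
    (fun s hs => Or.inr (Set.mem_image_of_mem _ (Set.Ico_subset_Icc_self hs))) h0
    ⟨ht, le_rfl⟩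

end ODE

/-- Only the upper bound `ρ` is integrated, so no integrability of `E'` is required. -/
lemma sub_le_integral_of_hasDerivWithinAt_le {E E' ρ : ℝ → ℝ} {T : ℝ}
    (hE : ∀ t ∈ Set.Icc 0 T, HasDerivWithinAt E (E' t) (Set.Icc 0 T) t)
    (hρ : ContinuousOn ρ (Set.Icc 0 T)) (h : ∀ t ∈ Set.Icc 0 T, E' t ≤ ρ t)
    {t : ℝ} (ht : t ∈ Set.Icc 0 T) : E t - E 0 ≤ ∫ s in (0 : ℝ)..t, ρ s := by
  have hsub : Set.Icc 0 t ⊆ Set.Icc 0 T := Set.Icc_subset_Icc_right ht.2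
  refine intervalIntegral.sub_le_integral_of_hasDeriv_right_of_le_Ico ht.1
    (continuousOn_Icc_of_hasDerivWithinAt hsub hE)
    (fun s hs => (hasDerivWithinAt_Ici_of_Icc hsub hs
      (hE s (hsub (Set.Ico_subset_Icc_self hs)))).mono Set.Ioi_subset_Ici_self)
    (hρ.mono hsub).integrableOn_Icc
    (fun s hs => h s (hsub (Set.Ico_subset_Icc_self hs)))

/-! ### Energy estimates for the time-slowed Galerkin equation. -/

section Energy

variable {U : Set Plane} {φ : ℝ → ℝ} {ε η : ℝ} {n : ℕ} {f : Fin n → Plane → ℝ}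

/-- The vector field of the Galerkin system in the coordinates of an `L²`-orthonormal basis. -/
noncomputable def galerkinField (U : Set Plane) (φ : ℝ → ℝ) (ε η : ℝ) (f : Fin n → Plane → ℝ)
    (γ : Fin n → ℝ) (x : (Fin n → ℝ) × (Fin n → ℝ)) : (Fin n → ℝ) × (Fin n → ℝ) :=
  (fun j => weakRhsU U φ η (comb f γ) (comb f x.1) (comb f x.2) (f j),
    fun j => weakRhsZ U φ ε (comb f x.1) (comb f x.2) (f j))

lemma locallyLipschitz_galerkinField (hU : IsOpen U) (hb : Bornology.IsBounded U)
    (hφ : IsCutoff φ) (hf : ∀ i, IsBoundedC1 U (f i)) (γ : Fin n → ℝ) :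
    LocallyLipschitz (galerkinField U φ ε η f γ) :=
  (locallyLipschitz_pi fun j => locallyLipschitz_weakRhsU hU hb hφ hf γ j).prodMk
    (locallyLipschitz_pi fun j => locallyLipschitz_weakRhsZ hU hb hφ hf j)

lemma hasDerivWithinAt_sum_sq {a a' : ℝ → Fin n → ℝ} {J : Set ℝ} {t : ℝ}
    (h : ∀ j, HasDerivWithinAt (fun s => a s j) (a' t j) J t) :
    HasDerivWithinAt (fun s => ∑ j, a s j ^ 2) (2 * ∑ j, a t j * a' t j) J t := by
  have := HasDerivWithinAt.fun_sum (u := Finset.univ) fun j _ => (h j).fun_pow 2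
  refine this.congr_deriv ?_
  rw [Finset.mul_sum]
  exact Finset.sum_congr rfl fun j _ => by norm_num; ring

variable {T : ℝ} {γ : Fin n → ℝ} {χ : ℝ → ℝ} {α : ℝ → (Fin n → ℝ) × (Fin n → ℝ)}

/-- The Dirichlet integral of the linear combination with coefficients `a`. -/
noncomputable def dirichlet (U : Set Plane) (f : Fin n → Plane → ℝ) (a : Fin n → ℝ) : ℝ :=
  ∫ x in U, ‖gradient (comb f a) x‖ ^ 2

lemma dirichlet_nonneg (a : Fin n → ℝ) : 0 ≤ dirichlet U f a :=
  integral_nonneg fun _ => by positivity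

lemma continuousOn_dirichlet_fst (hU : IsOpen U) (hb : Bornology.IsBounded U)
    (hf : ∀ i, IsBoundedC1 U (f i)) {J : Set ℝ} (hα : ContinuousOn α J) :
    ContinuousOn (fun t => dirichlet U f (α t).1) J :=
  (continuous_dirichlet_comb hU hb hf).comp_continuousOn (continuous_fst.comp_continuousOn hα)

lemma continuousOn_dirichlet_snd (hU : IsOpen U) (hb : Bornology.IsBounded U)
    (hf : ∀ i, IsBoundedC1 U (f i)) {J : Set ℝ} (hα : ContinuousOn α J) :
    ContinuousOn (fun t => dirichlet U f (α t).2) J :=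
  (continuous_dirichlet_comb hU hb hf).comp_continuousOn (continuous_snd.comp_continuousOn hα)

lemma intervalIntegrable_of_mem_Icc {h : ℝ → ℝ} (hh : ContinuousOn h (Set.Icc 0 T)) {t : ℝ}
    (ht : t ∈ Set.Icc 0 T) : IntervalIntegrable h volume 0 t :=
  (hh.mono (by rw [Set.uIcc_of_le ht.1]; exact Set.Icc_subset_Icc_right ht.2)).intervalIntegrable

/-- By linearity in the test function, pairing the field with the coefficients amounts to testing
with the solution itself. The factor `χ` stays on the dissipation, while in the source term it is
bounded by `1`. -/
lemma energy_fst_le (hU : IsOpen U) (hb : Bornology.IsBounded U) (hφ : IsCutoff φ)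
    (hf : ∀ i, IsBoundedC1 U (f i)) (hχ : ContinuousOn χ (Set.Icc 0 T))
    (hχ1 : ∀ t, 0 ≤ χ t ∧ χ t ≤ 1) (hα : ∀ t ∈ Set.Icc 0 T,
      HasDerivWithinAt α (χ t • galerkinField U φ ε η f γ (α t)) (Set.Icc 0 T) t)
    {t : ℝ} (ht : t ∈ Set.Icc 0 T) :
    ∑ j, (α t).1 j ^ 2 + 2 * η * ∫ s in (0 : ℝ)..t, χ s * dirichlet U f (α s).1
      ≤ ∑ j, (α 0).1 j ^ 2 + t * ∫ x in U, comb f γ x ^ 2 := by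
  have hc : ContinuousOn α (Set.Icc 0 T) := fun t ht => (hα t ht).continuousWithinAt
  have hD : ContinuousOn (fun s => χ s * dirichlet U f (α s).1) (Set.Icc 0 T) :=
    hχ.mul (continuousOn_dirichlet_fst hU hb hf hc)
  have hG : 0 ≤ ∫ x in U, comb f γ x ^ 2 := integral_nonneg fun _ => by positivity
  have hder : ∀ t ∈ Set.Icc 0 T, HasDerivWithinAt (fun s => ∑ j, (α s).1 j ^ 2)
      (2 * ∑ j, (α t).1 j * (χ t • galerkinField U φ ε η f γ (α t)).1 j) (Set.Icc 0 T) t :=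
    fun t ht => hasDerivWithinAt_sum_sq (a := fun s => (α s).1)
      (a' := fun t => (χ t • galerkinField U φ ε η f γ (α t)).1)
      (hasDerivWithinAt_pi.1 (hα t ht).fst)
  have hle : ∀ t ∈ Set.Icc 0 T,
      2 * ∑ j, (α t).1 j * (χ t • galerkinField U φ ε η f γ (α t)).1 j
        ≤ -(2 * η) * (χ t * dirichlet U f (α t).1) + ∫ x in U, comb f γ x ^ 2 := by
    intro t _
    have hu := isBoundedC1_comb hU hf (α t).1
    have hz := isBoundedC1_comb hU hf (α t).2
    have hγ := isBoundedC1_comb hU hf γ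
    have h1 := weakRhsU_comb (η := η) hU hb hφ hf hγ hu hz (α t).1
    have h2 := weakRhsU_self_le (η := η) hU hb hφ hγ hu hz
    have h3 : ∑ j, (α t).1 j * (χ t • galerkinField U φ ε η f γ (α t)).1 j
        = χ t * weakRhsU U φ η (comb f γ) (comb f (α t).1) (comb f (α t).2) (comb f (α t).1) := by
      rw [h1, Finset.mul_sum]
      refine Finset.sum_congr rfl fun j _ => ?_
      simp only [galerkinField, Prod.smul_fst, Pi.smul_apply, smul_eq_mul]
      ring
    rw [h3]
    have h4 := mul_le_mul_of_nonneg_left h2 (hχ1 t).1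
    have h5 := mul_le_mul_of_nonneg_right (hχ1 t).2 hG
    change _ ≤ χ t * (_ * dirichlet U f (α t).1 + _) at h4
    linarith
  have := sub_le_integral_of_hasDerivWithinAt_le
    (ρ := fun s => -(2 * η) * (χ s * dirichlet U f (α s).1) + ∫ x in U, comb f γ x ^ 2) hder
    ((continuousOn_const.mul hD).add continuousOn_const) hle ht
  rw [intervalIntegral.integral_add ((intervalIntegrable_of_mem_Icc hD ht).const_mul _)
    intervalIntegrable_const, intervalIntegral.integral_const_mul,
    intervalIntegral.integral_const, smul_eq_mul, sub_zero] at this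
  linarith

/-- The Dirichlet integral of the first component appears with the same weight `χ` as in
`energy_fst_le`. This match is what lets the two estimates be chained without any lower bound on
`χ`. -/
lemma energy_snd_le (hU : IsOpen U) (hb : Bornology.IsBounded U) (hφ : IsCutoff φ)
    (hf : ∀ i, IsBoundedC1 U (f i)) {M : ℝ} (hM : ∀ s, |deriv φ s * φ s * s| ≤ M) (hε : 0 < ε)
    (hχ : ContinuousOn χ (Set.Icc 0 T))
    (hχ1 : ∀ t, 0 ≤ χ t ∧ χ t ≤ 1) (hα : ∀ t ∈ Set.Icc 0 T,
      HasDerivWithinAt α (χ t • galerkinField U φ ε η f γ (α t)) (Set.Icc 0 T) t)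
    {t : ℝ} (ht : t ∈ Set.Icc 0 T) :
    ∑ j, (α t).2 j ^ 2 + 4 * ε * ∫ s in (0 : ℝ)..t, χ s * dirichlet U f (α s).2
      ≤ ∑ j, (α 0).2 j ^ 2 + 2 * M * (∫ s in (0 : ℝ)..t, χ s * dirichlet U f (α s).1)
        + t * (volume.real U / (4 * ε)) := by
  have hc : ContinuousOn α (Set.Icc 0 T) := fun t ht => (hα t ht).continuousWithinAt
  have hD : ContinuousOn (fun s => χ s * dirichlet U f (α s).1) (Set.Icc 0 T) :=
    hχ.mul (continuousOn_dirichlet_fst hU hb hf hc)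
  have hD' : ContinuousOn (fun s => χ s * dirichlet U f (α s).2) (Set.Icc 0 T) :=
    hχ.mul (continuousOn_dirichlet_snd hU hb hf hc)
  have hG : 0 ≤ volume.real U / (4 * ε) := div_nonneg measureReal_nonneg (by positivity)
  have hder : ∀ t ∈ Set.Icc 0 T, HasDerivWithinAt (fun s => ∑ j, (α s).2 j ^ 2)
      (2 * ∑ j, (α t).2 j * (χ t • galerkinField U φ ε η f γ (α t)).2 j) (Set.Icc 0 T) t :=
    fun t ht => hasDerivWithinAt_sum_sq (a := fun s => (α s).2)
      (a' := fun t => (χ t • galerkinField U φ ε η f γ (α t)).2)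
      (hasDerivWithinAt_pi.1 (hα t ht).snd)
  have hle : ∀ t ∈ Set.Icc 0 T,
      2 * ∑ j, (α t).2 j * (χ t • galerkinField U φ ε η f γ (α t)).2 j
        ≤ -(4 * ε) * (χ t * dirichlet U f (α t).2) + 2 * M * (χ t * dirichlet U f (α t).1)
          + volume.real U / (4 * ε) := by
    intro t _
    have hu := isBoundedC1_comb hU hf (α t).1
    have hz := isBoundedC1_comb hU hf (α t).2
    have h1 := weakRhsZ_comb (ε := ε) hU hb hφ hf hu hz (α t).2
    have h2 := weakRhsZ_self_le hU hb hφ hM hε hu hz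
    have h3 : ∑ j, (α t).2 j * (χ t • galerkinField U φ ε η f γ (α t)).2 j
        = χ t * weakRhsZ U φ ε (comb f (α t).1) (comb f (α t).2) (comb f (α t).2) := by
      rw [h1, Finset.mul_sum]
      refine Finset.sum_congr rfl fun j _ => ?_
      simp only [galerkinField, Prod.smul_snd, Pi.smul_apply, smul_eq_mul]
      ring
    rw [h3]
    have h4 := mul_le_mul_of_nonneg_left h2 (hχ1 t).1
    have h5 := mul_le_mul_of_nonneg_right (hχ1 t).2 hG
    change _ ≤ χ t * (_ * dirichlet U f (α t).2 + _ * dirichlet U f (α t).1 + _) at h4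
    linarith
  have := sub_le_integral_of_hasDerivWithinAt_le
    (ρ := fun s => -(4 * ε) * (χ s * dirichlet U f (α s).2)
      + 2 * M * (χ s * dirichlet U f (α s).1) + volume.real U / (4 * ε)) hder
    (((continuousOn_const.mul hD').add (continuousOn_const.mul hD)).add continuousOn_const) hle ht
  rw [intervalIntegral.integral_add (((intervalIntegrable_of_mem_Icc hD' ht).const_mul _).add
    ((intervalIntegrable_of_mem_Icc hD ht).const_mul _)) intervalIntegrable_const,
    intervalIntegral.integral_add ((intervalIntegrable_of_mem_Icc hD' ht).const_mul _)
    ((intervalIntegrable_of_mem_Icc hD ht).const_mul _), intervalIntegral.integral_const_mul,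
    intervalIntegral.integral_const_mul,
    intervalIntegral.integral_const, smul_eq_mul, sub_zero] at this
  linarith

end Energy

end AmbrosioTortorelli

namespace AmbrosioTortorelli

variable {U : Set Plane} {φ : ℝ → ℝ} {ε η T : ℝ} {n : ℕ} {f : Fin n → Plane → ℝ}

/-! ### Coefficients in the orthonormal basis, projections and Bessel's inequality. -/

section Coefficients

/-- The `L²(U)` coefficients of `v` with respect to the functions `f i`. -/
noncomputable def coeff (U : Set Plane) (f : Fin n → Plane → ℝ) (v : Plane → ℝ) (i : Fin n) : ℝ :=
  ∫ x in U, v x * f i x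

variable {V : Submodule ℝ (Plane → ℝ)}

lemma comb_mem (hB : IsL2OrthonormalBasis U f V) (a : Fin n → ℝ) : comb f a ∈ V :=
  Submodule.sum_mem _ fun i _ => Submodule.smul_mem _ _ (hB.mem i)

lemma comb_coeff (hB : IsL2OrthonormalBasis U f V) {v : Plane → ℝ} (hv : v ∈ V) :
    comb f (coeff U f v) = v := (hB.eq_sum v hv).symm

lemma coeff_comb (hU : IsOpen U) (hb : Bornology.IsBounded U) (hf : ∀ i, IsBoundedC1 U (f i))
    (hB : IsL2OrthonormalBasis U f V) (a : Fin n → ℝ) : coeff U f (comb f a) = a := by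
  ext i
  have h := integral_mul_comb (k := f i) (fun j => (hf i).integrableOn_mul hU hb (hf j)) a
  simp only [hB.integral_mul, mul_ite, mul_one, mul_zero, Finset.sum_ite_eq, Finset.mem_univ,
    if_true] at h
  simpa only [coeff, mul_comm] using h

lemma integral_comb_mul_comb (hU : IsOpen U) (hb : Bornology.IsBounded U)
    (hf : ∀ i, IsBoundedC1 U (f i)) (hB : IsL2OrthonormalBasis U f V) (a c : Fin n → ℝ) :
    ∫ x in U, comb f a x * comb f c x = ∑ j, a j * c j := by
  rw [integral_mul_comb fun j => (isBoundedC1_comb hU hf a).integrableOn_mul hU hb (hf j)]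
  refine Finset.sum_congr rfl fun j _ => ?_
  rw [mul_comm]
  exact congrArg (· * c j) (congrFun (coeff_comb hU hb hf hB a) j)

lemma integral_comb_sq (hU : IsOpen U) (hb : Bornology.IsBounded U)
    (hf : ∀ i, IsBoundedC1 U (f i)) (hB : IsL2OrthonormalBasis U f V) (a : Fin n → ℝ) :
    ∫ x in U, comb f a x ^ 2 = ∑ j, a j ^ 2 := by
  simpa only [sq] using integral_comb_mul_comb hU hb hf hB a a

lemma integral_mul_comb_coeff (hU : IsOpen U) (hb : Bornology.IsBounded U)
    (hf : ∀ i, IsBoundedC1 U (f i)) {g : Plane → ℝ}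
    (hg : MemLp g 2 (volume.restrict U)) (c : Fin n → ℝ) :
    ∫ x in U, g x * comb f c x = ∑ j, c j * coeff U f g j :=
  integral_mul_comb (fun j => hg.integrable_mul ((hf j).memLp hU hb)) c

lemma isL2Projection_comb_coeff (hU : IsOpen U) (hb : Bornology.IsBounded U)
    (hf : ∀ i, IsBoundedC1 U (f i)) (hB : IsL2OrthonormalBasis U f V) {g : Plane → ℝ}
    (hg : MemLp g 2 (volume.restrict U)) : IsL2Projection U V g (comb f (coeff U f g)) := by
  refine ⟨comb_mem hB _, fun ψ hψ => ?_⟩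
  rw [← comb_coeff hB hψ]
  set c := coeff U f ψ
  have hc := isBoundedC1_comb hU hf c
  have h1 : IntegrableOn (fun x => g x * comb f c x) U := hg.integrable_mul (hc.memLp hU hb)
  have h2 := (isBoundedC1_comb hU hf (coeff U f g)).integrableOn_mul hU hb hc
  simp only [sub_mul]
  rw [integral_sub h1 h2, integral_mul_comb_coeff hU hb hf hg,
    integral_comb_mul_comb hU hb hf hB, sub_eq_zero]
  exact Finset.sum_congr rfl fun j _ => mul_comm _ _

lemma IsL2Projection.coeff_eq (hU : IsOpen U) (hb : Bornology.IsBounded U)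
    (hf : ∀ i, IsBoundedC1 U (f i)) (hB : IsL2OrthonormalBasis U f V)
    (hV : V ≤ boundedC1 hU) {g w : Plane → ℝ}
    (hg : MemLp g 2 (volume.restrict U)) (h : IsL2Projection U V g w) :
    coeff U f w = coeff U f g := by
  ext i
  have h0 := h.2 (f i) (hB.mem i)
  have h1 : IntegrableOn (fun x => g x * f i x) U := hg.integrable_mul ((hf i).memLp hU hb)
  have h2 := (hV h.1 : IsBoundedC1 U w).integrableOn_mul hU hb (hf i)
  simp only [sub_mul] at h0
  rw [integral_sub h1 h2, sub_eq_zero] at h0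
  exact h0.symm

/-- Bessel's inequality. -/
lemma sum_coeff_sq_le (hU : IsOpen U) (hb : Bornology.IsBounded U)
    (hf : ∀ i, IsBoundedC1 U (f i)) (hB : IsL2OrthonormalBasis U f V) {g : Plane → ℝ}
    (hg : MemLp g 2 (volume.restrict U)) : ∑ j, coeff U f g j ^ 2 ≤ ∫ x in U, g x ^ 2 := by
  set c := coeff U f g with hc
  have hcb := isBoundedC1_comb hU hf c
  have h1 : IntegrableOn (fun x => g x * comb f c x) U := hg.integrable_mul (hcb.memLp hU hb)
  have h2 : IntegrableOn (fun x => comb f c x ^ 2) U := (hcb.memLp hU hb).integrable_sq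
  have h4 : ∫ x in U, g x * comb f c x = ∑ j, c j ^ 2 := by
    rw [integral_mul_comb_coeff hU hb hf hg]
    exact Finset.sum_congr rfl fun j _ => by rw [sq]
  -- This is `0 ≤ (g - p)²` integrated, where `p` is the projection and `∫ g p = ∫ p²`.
  have h5 : ∫ x in U, (2 * (g x * comb f c x) - comb f c x ^ 2) ≤ ∫ x in U, g x ^ 2 :=
    integral_mono ((h1.const_mul 2).sub h2) hg.integrable_sq fun x => by
      nlinarith [sq_nonneg (g x - comb f c x)]
  rw [integral_sub (h1.const_mul 2) h2, integral_const_mul, h4,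
    integral_comb_sq hU hb hf hB] at h5
  linarith

end Coefficients

/-! ### Passage between Galerkin solutions and trajectories of coefficients. -/

section Translation

variable {e : ℕ → Plane → ℝ} {N : ℕ} {g u₀ z₀ : Plane → ℝ} {J : Set ℝ}

/-- Both sides of each weak equation are linear in `ψ`, so the equations for the basis functions
give those for every test function. -/
lemma isGalerkinSolution_comb (hU : IsOpen U) (hb : Bornology.IsBounded U) (hφ : IsCutoff φ)
    (hf : ∀ i, IsBoundedC1 U (f i)) (hB : IsL2OrthonormalBasis U f (galerkinSpace e N))
    (hg : MemLp g 2 (volume.restrict U)) (hu₀ : MemLp u₀ 2 (volume.restrict U))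
    (hz₀ : MemLp z₀ 2 (volume.restrict U)) {α : ℝ → (Fin n → ℝ) × (Fin n → ℝ)}
    (h0 : α 0 = (coeff U f u₀, coeff U f z₀))
    (hα : ∀ t ∈ J, HasDerivWithinAt α (galerkinField U φ ε η f (coeff U f g) (α t)) J t) :
    IsGalerkinSolution U φ ε η g u₀ z₀ e N J
      (fun t => comb f (α t).1) (fun t => comb f (α t).2) where
  mem_u t _ := comb_mem hB _
  mem_z t _ := comb_mem hB _
  init_u := by rw [h0]; exact isL2Projection_comb_coeff hU hb hf hB hu₀
  init_z := by rw [h0]; exact isL2Projection_comb_coeff hU hb hf hB hz₀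
  eq_u := by
    refine ⟨_, isL2Projection_comb_coeff hU hb hf hB hg, fun t ht ψ hψ => ?_⟩
    rw [← comb_coeff hB hψ]
    simp only [integral_comb_mul_comb hU hb hf hB]
    have h1 := weakRhsU_comb (η := η) hU hb hφ hf (isBoundedC1_comb hU hf (coeff U f g))
      (isBoundedC1_comb hU hf (α t).1) (isBoundedC1_comb hU hf (α t).2) (coeff U f ψ)
    refine HasDerivWithinAt.congr_deriv ?_ h1.symm
    simp only [mul_comm]
    refine HasDerivWithinAt.fun_sum fun j _ => ?_
    have h2 := (hasDerivWithinAt_pi.1 (hα t ht).fst j).const_mul (coeff U f ψ j)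
    exact h2
  eq_z t ht ψ hψ := by
    rw [← comb_coeff hB hψ]
    simp only [integral_comb_mul_comb hU hb hf hB]
    have h1 := weakRhsZ_comb (ε := ε) hU hb hφ hf
      (isBoundedC1_comb hU hf (α t).1) (isBoundedC1_comb hU hf (α t).2) (coeff U f ψ)
    refine HasDerivWithinAt.congr_deriv ?_ h1.symm
    simp only [mul_comm]
    refine HasDerivWithinAt.fun_sum fun j _ => ?_
    have h2 := (hasDerivWithinAt_pi.1 (hα t ht).snd j).const_mul (coeff U f ψ j)
    exact h2

/-- Converse direction: the equations are tested with the `f j`. The existentially quantified `gN`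
is harmless, since its coefficients are forced to be those of `g`. -/
lemma IsGalerkinSolution.hasDerivWithinAt_coeff (hU : IsOpen U) (hb : Bornology.IsBounded U)
    (hf : ∀ i, IsBoundedC1 U (f i)) (hB : IsL2OrthonormalBasis U f (galerkinSpace e N))
    (hV : galerkinSpace e N ≤ boundedC1 hU) (hg : MemLp g 2 (volume.restrict U))
    {u z : ℝ → Plane → ℝ} (h : IsGalerkinSolution U φ ε η g u₀ z₀ e N J u z) {t : ℝ} (ht : t ∈ J) :
    HasDerivWithinAt (fun s => (coeff U f (u s), coeff U f (z s)))
      (galerkinField U φ ε η f (coeff U f g) (coeff U f (u t), coeff U f (z t))) J t := by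
  obtain ⟨gN, hgN, heq⟩ := h.eq_u
  have hgN' : comb f (coeff U f g) = gN := by
    rw [← hgN.coeff_eq hU hb hf hB hV hg, comb_coeff hB hgN.1]
  unfold galerkinField
  simp only [hgN', comb_coeff hB (h.mem_u t ht), comb_coeff hB (h.mem_z t ht)]
  exact (hasDerivWithinAt_pi.2 fun j => heq t ht (f j) (hB.mem j)).prodMk
    (hasDerivWithinAt_pi.2 fun j => h.eq_z t ht (f j) (hB.mem j))

/-- Bounds on `[0, T]` pass to any nonempty measurable `J` inside it because the dissipation is
nonnegative. This treats half-open and closed intervals alike. -/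
lemma energyBound_of_comb (hU : IsOpen U) (hb : Bornology.IsBounded U)
    (hf : ∀ i, IsBoundedC1 U (f i)) (hB : IsL2OrthonormalBasis U f (galerkinSpace e N))
    (hJ : MeasurableSet J) (hJne : J.Nonempty) (hJT : J ⊆ Set.Icc 0 T) (hT : 0 ≤ T)
    {a : ℝ → Fin n → ℝ} {u : ℝ → Plane → ℝ} (hu : ∀ t ∈ J, u t = comb f (a t))
    {A D C : ℝ} (hA : ∀ t ∈ Set.Icc 0 T, ∑ j, a t j ^ 2 ≤ A)
    (hc : ContinuousOn (fun t => dirichlet U f (a t)) (Set.Icc 0 T))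
    (hD : ∫ s in (0 : ℝ)..T, dirichlet U f (a s) ≤ D) (hC : A + D ≤ C) : EnergyBound U J u C := by
  have hint : IntegrableOn (fun t => dirichlet U f (a t)) (Set.Icc 0 T) := hc.integrableOn_Icc
  have hcongr : Set.EqOn (fun s => ∫ x in U, ‖gradient (u s) x‖ ^ 2)
      (fun s => dirichlet U f (a s)) J := fun s hs => by
    simp only [hu s hs, dirichlet]
  have hle : ∀ t : J, ∫ x in U, u t x ^ 2 ≤ A := fun t => by
    rw [hu t t.2, integral_comb_sq hU hb hf hB]
    exact hA t (hJT t.2)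
  refine ⟨⟨A, ?_⟩, (hint.mono_set hJT).congr_fun hcongr.symm hJ, ?_⟩
  · rintro _ ⟨t, rfl⟩
    exact hle t
  · have := hJne.to_subtype
    have h1 : ⨆ t : J, ∫ x in U, u t x ^ 2 ≤ A := ciSup_le hle
    have h2 : ∫ s in J, ∫ x in U, ‖gradient (u s) x‖ ^ 2
        ≤ ∫ s in (0 : ℝ)..T, dirichlet U f (a s) := by
      rw [setIntegral_congr_fun hJ hcongr, intervalIntegral.integral_of_le hT,
        ← integral_Icc_eq_integral_Ioc]
      exact setIntegral_mono_set hint (Filter.Eventually.of_forall fun s => dirichlet_nonneg _)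
        hJT.eventuallyLE
    linarith

end Translation

/-! ### A priori bounds with explicit constants. -/

section Apriori

variable {γ : Fin n → ℝ} {χ : ℝ → ℝ} {α : ℝ → (Fin n → ℝ) × (Fin n → ℝ)}

/-- The first estimate bounds the weighted dissipation of `u` by `A / (2 * η)`; inserted into the
second with the factor `2 * M`, it produces the term `M / η * A` of `B`. -/
lemma apriori_bounds (hU : IsOpen U) (hb : Bornology.IsBounded U) (hφ : IsCutoff φ)
    (hf : ∀ i, IsBoundedC1 U (f i)) {M : ℝ} (hM0 : 0 ≤ M) (hM : ∀ s, |deriv φ s * φ s * s| ≤ M)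
    (hε : 0 < ε) (hη : 0 < η) (hχ : ContinuousOn χ (Set.Icc 0 T))
    (hχ1 : ∀ t, 0 ≤ χ t ∧ χ t ≤ 1) (hα : ∀ t ∈ Set.Icc 0 T,
      HasDerivWithinAt α (χ t • galerkinField U φ ε η f γ (α t)) (Set.Icc 0 T) t)
    {G A₀ B₀ A B : ℝ} (hG : ∫ x in U, comb f γ x ^ 2 ≤ G) (hA₀ : ∑ j, (α 0).1 j ^ 2 ≤ A₀)
    (hB₀ : ∑ j, (α 0).2 j ^ 2 ≤ B₀) (hA : A = A₀ + T * G)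
    (hBdef : B = B₀ + M / η * A + T * (volume.real U / (4 * ε)))
    {t : ℝ} (ht : t ∈ Set.Icc 0 T) :
    ∑ j, (α t).1 j ^ 2 ≤ A ∧ ∑ j, (α t).2 j ^ 2 ≤ B ∧
      ∫ s in (0 : ℝ)..t, χ s * dirichlet U f (α s).1 ≤ A / (2 * η) ∧
      ∫ s in (0 : ℝ)..t, χ s * dirichlet U f (α s).2 ≤ B / (4 * ε) := by
  have h1 := energy_fst_le hU hb hφ hf hχ hχ1 hα ht
  have h2 := energy_snd_le hU hb hφ hf hM hε hχ hχ1 hα ht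
  have hD1 : 0 ≤ ∫ s in (0 : ℝ)..t, χ s * dirichlet U f (α s).1 :=
    intervalIntegral.integral_nonneg ht.1 fun s _ => mul_nonneg (hχ1 s).1 (dirichlet_nonneg _)
  have hD2 : 0 ≤ ∫ s in (0 : ℝ)..t, χ s * dirichlet U f (α s).2 :=
    intervalIntegral.integral_nonneg ht.1 fun s _ => mul_nonneg (hχ1 s).1 (dirichlet_nonneg _)
  have hG0 : 0 ≤ ∫ x in U, comb f γ x ^ 2 := integral_nonneg fun _ => by positivity
  have h3 : t * ∫ x in U, comb f γ x ^ 2 ≤ T * G :=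
    mul_le_mul ht.2 hG hG0 (ht.1.trans ht.2)
  have h4 : t * (volume.real U / (4 * ε)) ≤ T * (volume.real U / (4 * ε)) :=
    mul_le_mul_of_nonneg_right ht.2 (div_nonneg measureReal_nonneg (by positivity))
  have hs1 : 0 ≤ ∑ j, (α t).1 j ^ 2 := Finset.sum_nonneg fun _ _ => sq_nonneg _
  have hs2 : 0 ≤ ∑ j, (α t).2 j ^ 2 := Finset.sum_nonneg fun _ _ => sq_nonneg _
  set D1 := ∫ s in (0 : ℝ)..t, χ s * dirichlet U f (α s).1
  set D2 := ∫ s in (0 : ℝ)..t, χ s * dirichlet U f (α s).2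
  have h5 : 0 ≤ 2 * η * D1 := by positivity
  have h6 : 0 ≤ 4 * ε * D2 := by positivity
  have h7 : D1 ≤ A / (2 * η) := by
    rw [le_div_iff₀ (by positivity)]
    linarith
  have h8 : 2 * M * D1 ≤ M / η * A := by
    calc 2 * M * D1 ≤ 2 * M * (A / (2 * η)) := by gcongr
      _ = M / η * A := by field_simp
  refine ⟨by linarith, by linarith, h7, ?_⟩
  rw [le_div_iff₀ (by positivity)]
  linarith

/-- A crude bound from `2 |a j| ≤ a j ^ 2 + 1`, which avoids square roots. -/
lemma norm_le_of_sum_sq_le {a : Fin n → ℝ} {A : ℝ} (h : ∑ j, a j ^ 2 ≤ A) : ‖a‖ ≤ A + 1 := by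
  have hA : 0 ≤ A := (Finset.sum_nonneg fun _ _ => sq_nonneg _).trans h
  refine (pi_norm_le_iff_of_nonneg (by linarith)).2 fun j => ?_
  have := (Finset.single_le_sum (f := fun j => a j ^ 2) (fun _ _ => sq_nonneg _)
    (Finset.mem_univ j)).trans h
  rw [Real.norm_eq_abs]
  nlinarith [sq_abs (a j), sq_nonneg (|a j| - 1)]

end Apriori

end AmbrosioTortorelli

/-! ### The main theorem. -/

open AmbrosioTortorelli in
theorem proposition2p5
    (U : Set AmbrosioTortorelli.Plane) (hU : AmbrosioTortorelli.IsBoundedC2Domain U)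
    (φ : ℝ → ℝ) (hφ : AmbrosioTortorelli.IsCutoff φ)
    (ε η T : ℝ) (hε : 0 < ε) (hη : 0 < η) (hT : 0 < T)
    (g u₀ z₀ : AmbrosioTortorelli.Plane → ℝ)
    (hg : MeasureTheory.MemLp g 2 (MeasureTheory.volume.restrict U))
    (hu₀ : MeasureTheory.MemLp u₀ 2 (MeasureTheory.volume.restrict U))
    (hz₀ : MeasureTheory.MemLp z₀ 2 (MeasureTheory.volume.restrict U))
    (lam : ℕ → ℝ) (e : ℕ → AmbrosioTortorelli.Plane → ℝ)
    (he : AmbrosioTortorelli.IsNeumannEigenbasis U lam e) :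
    ∃ C : ℝ, 0 < C ∧ ∀ N : ℕ,
      -- every local solution satisfies the bounds and extends to the whole of `[0, T]`
      (∀ τ : ℝ, 0 < τ → τ ≤ T → ∀ J : Set ℝ, (J = Set.Ico 0 τ ∨ J = Set.Icc 0 τ) →
        ∀ u z : ℝ → AmbrosioTortorelli.Plane → ℝ,
          AmbrosioTortorelli.IsGalerkinSolution U φ ε η g u₀ z₀ e N J u z →
          AmbrosioTortorelli.EnergyBound U J u C ∧
          AmbrosioTortorelli.EnergyBound U J z C ∧
          ∃ u' z' : ℝ → AmbrosioTortorelli.Plane → ℝ,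
            AmbrosioTortorelli.IsGalerkinSolution U φ ε η g u₀ z₀ e N (Set.Icc 0 T) u' z' ∧
            (∀ t ∈ J, Set.EqOn (u' t) (u t) U ∧ Set.EqOn (z' t) (z t) U) ∧
            AmbrosioTortorelli.EnergyBound U (Set.Icc 0 T) u' C ∧
            AmbrosioTortorelli.EnergyBound U (Set.Icc 0 T) z' C) ∧
      -- a solution on `[0, T]` exists, with the same bounds
      ∃ u z : ℝ → AmbrosioTortorelli.Plane → ℝ,
        AmbrosioTortorelli.IsGalerkinSolution U φ ε η g u₀ z₀ e N (Set.Icc 0 T) u z ∧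
        AmbrosioTortorelli.EnergyBound U (Set.Icc 0 T) u C ∧
        AmbrosioTortorelli.EnergyBound U (Set.Icc 0 T) z C := by
  obtain ⟨M, hM0, hM⟩ := hφ.exists_bound
  have hUo := hU.isOpen
  have hUb := hU.isBounded
  -- `A` and `B` are built from the full data rather than from projections, and are fixed before `N`
  -- is introduced.
  obtain ⟨A, hA⟩ : ∃ A, A = (∫ x in U, u₀ x ^ 2) + T * ∫ x in U, g x ^ 2 := ⟨_, rfl⟩
  obtain ⟨B, hBdef⟩ : ∃ B, B = (∫ x in U, z₀ x ^ 2) + M / η * A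
      + T * (volume.real U / (4 * ε)) := ⟨_, rfl⟩
  have hsq : ∀ v : Plane → ℝ, 0 ≤ ∫ x in U, v x ^ 2 := fun v =>
    integral_nonneg fun _ => sq_nonneg _
  have hA0 : 0 ≤ A := hA ▸ add_nonneg (hsq u₀) (mul_nonneg hT.le (hsq g))
  have hB0 : 0 ≤ B := by
    have := hsq z₀
    rw [hBdef]
    positivity
  have hA1 : 0 ≤ A / (2 * η) := by positivity
  have hB1 : 0 ≤ B / (4 * ε) := by positivity
  -- The sum dominates both energy bounds at once; the final `1` gives positivity without examining
  -- the data.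
  refine ⟨A + A / (2 * η) + B + B / (4 * ε) + 1, by positivity, fun N => ?_⟩
  obtain ⟨n, f, hB⟩ := exists_isL2OrthonormalBasis hU he N
  have hV := galerkinSpace_le hU he N
  have hf : ∀ i, IsBoundedC1 U (f i) := fun i => hV (hB.mem i)
  have hG : ∫ x in U, comb f (coeff U f g) x ^ 2 ≤ ∫ x in U, g x ^ 2 := by
    rw [integral_comb_sq hUo hUb hf hB]
    exact sum_coeff_sq_le hUo hUb hf hB hg
  have hlip := locallyLipschitz_galerkinField (ε := ε) (η := η) hUo hUb hφ hf (coeff U f g)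
  have hap : ∀ (χ : ℝ → ℝ) (α : ℝ → (Fin n → ℝ) × (Fin n → ℝ)), ContinuousOn χ (Set.Icc 0 T) →
      (∀ t, 0 ≤ χ t ∧ χ t ≤ 1) → α 0 = (coeff U f u₀, coeff U f z₀) →
      (∀ t ∈ Set.Icc 0 T, HasDerivWithinAt α
        (χ t • galerkinField U φ ε η f (coeff U f g) (α t)) (Set.Icc 0 T) t) →
      ∀ t ∈ Set.Icc 0 T, ∑ j, (α t).1 j ^ 2 ≤ A ∧ ∑ j, (α t).2 j ^ 2 ≤ B ∧
        ∫ s in (0 : ℝ)..t, χ s * dirichlet U f (α s).1 ≤ A / (2 * η) ∧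
        ∫ s in (0 : ℝ)..t, χ s * dirichlet U f (α s).2 ≤ B / (4 * ε) :=
    fun χ α hχ hχ1 h0 hα t ht => apriori_bounds hUo hUb hφ hf hM0 hM hε hη hχ hχ1 hα hG
      (h0 ▸ sum_coeff_sq_le hUo hUb hf hB hu₀) (h0 ▸ sum_coeff_sq_le hUo hUb hf hB hz₀) hA hBdef ht
  obtain ⟨α, h0, hα⟩ := exists_hasDerivWithinAt_of_apriori hlip
    (x₀ := (coeff U f u₀, coeff U f z₀)) (R := A + B + 1) hT.le
    fun χ α hχ hχ1 h0 hα t ht => by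
      obtain ⟨h1, h2, -⟩ := hap χ α hχ hχ1 h0 hα t ht
      exact max_le ((norm_le_of_sum_sq_le h1).trans (by linarith))
        ((norm_le_of_sum_sq_le h2).trans (by linarith))
  -- For the solution of the untruncated equation the slowing factor is `1`, so the weighted
  -- integrals are the true dissipations.
  have hbd := hap (fun _ => 1) α continuousOn_const (fun _ => ⟨zero_le_one, le_rfl⟩) h0
    (by simpa only [one_smul] using hα)
  simp only [one_mul] at hbd
  have hαc : ContinuousOn α (Set.Icc 0 T) := fun t ht => (hα t ht).continuousWithinAt
  have hTT : T ∈ Set.Icc 0 T := ⟨hT.le, le_rfl⟩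
  have hEu : ∀ (J : Set ℝ) (u : ℝ → Plane → ℝ), MeasurableSet J → J.Nonempty → J ⊆ Set.Icc 0 T →
      (∀ t ∈ J, u t = comb f (α t).1) →
      EnergyBound U J u (A + A / (2 * η) + B + B / (4 * ε) + 1) := fun J u hJ hJne hJT hu =>
    energyBound_of_comb hUo hUb hf hB hJ hJne hJT hT.le hu (fun t ht => (hbd t ht).1)
      (continuousOn_dirichlet_fst hUo hUb hf hαc) (hbd T hTT).2.2.1 (by linarith)
  have hEz : ∀ (J : Set ℝ) (z : ℝ → Plane → ℝ), MeasurableSet J → J.Nonempty → J ⊆ Set.Icc 0 T →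
      (∀ t ∈ J, z t = comb f (α t).2) →
      EnergyBound U J z (A + A / (2 * η) + B + B / (4 * ε) + 1) := fun J z hJ hJne hJT hz =>
    energyBound_of_comb hUo hUb hf hB hJ hJne hJT hT.le hz (fun t ht => (hbd t ht).2.1)
      (continuousOn_dirichlet_snd hUo hUb hf hαc) (hbd T hTT).2.2.2 (by linarith)
  have hsol := isGalerkinSolution_comb hUo hUb hφ hf hB hg hu₀ hz₀ h0 hα
  have hEu' := hEu _ (fun t => comb f (α t).1) measurableSet_Icc ⟨T, hTT⟩ subset_rfl
    fun _ _ => rfl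
  have hEz' := hEz _ (fun t => comb f (α t).2) measurableSet_Icc ⟨T, hTT⟩ subset_rfl
    fun _ _ => rfl
  refine ⟨fun τ hτ hτT J hJ u z huz => ?_, _, _, hsol, hEu', hEz'⟩
  have hJm : MeasurableSet J := by
    rcases hJ with rfl | rfl
    exacts [measurableSet_Ico, measurableSet_Icc]
  have h0J : (0 : ℝ) ∈ J := by
    rcases hJ with rfl | rfl
    exacts [⟨le_rfl, hτ⟩, ⟨le_rfl, hτ.le⟩]
  have hJT : J ⊆ Set.Icc 0 T := by
    rcases hJ with rfl | rfl
    exacts [fun t ht => ⟨ht.1, ht.2.le.trans hτT⟩, Set.Icc_subset_Icc_right hτT]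
  have hJt : ∀ t ∈ J, Set.Icc 0 t ⊆ J := by
    rcases hJ with rfl | rfl
    exacts [fun t ht s hs => ⟨hs.1, hs.2.trans_lt ht.2⟩, fun t ht => Set.Icc_subset_Icc_right ht.2]
  -- Uniqueness identifies the given solution with the global trajectory on `J`, so its bounds and
  -- its extension are read off from `α`.
  have heq : ∀ t ∈ J, (coeff U f (u t), coeff U f (z t)) = α t := fun t ht => by
    refine eq_of_hasDerivWithinAt hlip (α := fun s => (coeff U f (u s), coeff U f (z s)))
      (hJT ht).1 (hJt t ht) (Set.Icc_subset_Icc_right (hJT ht).2)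
      (fun s hs => huz.hasDerivWithinAt_coeff hUo hUb hf hB hV hg hs) hα ?_
    rw [h0, huz.init_u.coeff_eq hUo hUb hf hB hV hu₀, huz.init_z.coeff_eq hUo hUb hf hB hV hz₀]
  have hu : ∀ t ∈ J, u t = comb f (α t).1 := fun t ht => by
    rw [← heq t ht, comb_coeff hB (huz.mem_u t ht)]
  have hz : ∀ t ∈ J, z t = comb f (α t).2 := fun t ht => by
    rw [← heq t ht, comb_coeff hB (huz.mem_z t ht)]
  refine ⟨hEu J u hJm ⟨0, h0J⟩ hJT hu, hEz J z hJm ⟨0, h0J⟩ hJT hz, _, _, hsol, fun t ht => ?_,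
    hEu', hEz'⟩
  rw [hu t ht, hz t ht]
  exact ⟨fun _ _ => rfl, fun _ _ => rfl⟩
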